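/- Consider the parametric shortest path algorithm for finding a minimum mean cycle, in its sourceless variant. Its input is a directed graph with $n$ vertices and $m$ edges (no loops, no parallel edges), given by a list of its edges, with a real cost $c(e)$ for each edge $e$. It maintains a tree $T$ of paths $t_w$ from an artificial source, which is joined to every vertex by an edge of cost $0$; $T$ initially consists of these edges. For each $w$ it maintains the cost $c(t_w)$ and the number $\delta(t_w)$ of edges of the original graph on $t_w$. The key of an edge $(u,v)$ is $$\frac{c(t_u)+c(u,v)-c(t_v)}{\delta(t_u)+1-\delta(t_v)}\quad\text{if }\delta(t_u)+1>\delta(t_v),\qquad\text{and }\infty\text{ otherwise};$$ the key of a vertex is the minimum of the keys of the edges that enter it. The vertex keys are stored in a Fibonacci heap, together with, for each vertex, an edge that determines its key. In each round the algorithm finds a vertex $v$ of minimum key. If this key is $\infty$, it stops: the graph has no cycle. Otherwise let $(u,v)$ be the edge that determines the key. If $v$ lies on $t_u$, the algorithm stops with the minimum mean cycle formed by the tree path from $v$ to $u$ and the edge $(u,v)$. Otherwise it replaces the tree edge into $v$ by $(u,v)$. For each vertex $w$ in the subtree of $v$ (these are the vertices whose path changes) it updates $c(t_w)$ and $\delta(t_w)$,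 recomputes the key of $w$ from the edges that enter $w$, and then checks whether the edges that leave $w$ decrease the keys of their heads. Let $R$ be the running time of this algorithm: the number of elementary steps (arithmetic operations and comparisons on reals, array accesses, and single insertions, deletions and concatenations on doubly linked lists) that it takes up to a constant factor, including initialization and all the work done inside the Fibonacci heap. Let $J$ be the number of shortest path changes, $J=\sum_w j_w$, where $j_w$ is the number of times that the path to $w$ changes. Run the algorithm on a random directed graph with $n$ vertices and $m$ edges, whose edge set is uniformly distributed over the $m$-element subsets of the $n(n-1)$ ordered pairs of distinct vertices. The edges may be listed in any order, and the edge costs may be random with an arbitrary distribution, possibly dependent on the graph. If the expected number of path changes is $O(n)$, then the expected running time is $O(m+n\log n)$. That is, for every constant $C\ge 0$ there is a constant $A$, depending only on $C$, such that for all $n\ge 2$ and all $m$, and every random directed graph with $n$ vertices and $m$ edges with random edge costs as above, $$\mathbb E(J)\le C\,n\quad\Longrightarrow\quad \mathbb E(R)\le A\,(m+n\log n).$$ -/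

import Mathlib

open MeasureTheory
open scoped ENNReal

/-!
The parametric shortest path algorithm with Fibonacci-heap vertex keys, in the sourceless variant
that finds a minimum mean cycle, with an explicit count of its steps.

Cost model: a real RAM with pointers. One unit of time pays for a bounded number of reads and
writes of array cells and list heads, arithmetic operations and comparisons of numbers, and
insertions into, deletions (of an item given by its handle) from, and concatenations of doubly
linked lists. Functions on `Fin n` play the role of arrays, lists that of doubly linked lists. The
heap is implemented, not postulated: its operations are charged for the work they really do.

The number field `K` is arbitrary, so that the algorithm can be run over `ℚ`; the theorem is about
`ℝ`.
-/

namespace ParametricPath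

/-! ### Fibonacci heaps -/

/-- A Fibonacci heap whose items are the vertices `0, …, n - 1`: heap-ordered trees given by parent
pointers and lists of children, the list of the roots of the trees, and mark bits. The rank of a
node is the length of its list of children. `time` is the time spent so far in heap operations. -/
structure FibHeap (n : ℕ) (K : Type*) where
  key : Fin n → WithTop K
  parent : Fin n → Option (Fin n)
  children : Fin n → List (Fin n)
  mark : Fin n → Bool
  roots : List (Fin n)
  time : ℕ

namespace FibHeap

variable {n : ℕ} {K : Type*}

/-- The empty heap. -/
def empty (n : ℕ) (K : Type*) : FibHeap n K where
  key _ := ⊤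
  parent _ := none
  children _ := []
  mark _ := false
  roots := []
  time := 0

/-- Insert the item `v`, which is not in the heap, with key `k`, as a one-node tree. -/
def insert (h : FibHeap n K) (v : Fin n) (k : WithTop K) : FibHeap n K :=
  { h with
    key := Function.update h.key v k
    roots := v :: h.roots
    time := h.time + 1 }

/-- Cut the subtree of `v` from the parent `z` of `v`, and make it a tree of its own. -/
def cut (h : FibHeap n K) (v z : Fin n) : FibHeap n K :=
  { h with
    parent := Function.update h.parent v none
    children := Function.update h.children z ((h.children z).erase v)
    mark := Function.update h.mark v false
    roots := v :: h.roots
    time := h.time + 1 }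

/-- Cascading cuts, after `y` has lost a child: a root is left alone, an unmarked node is marked,
a marked node is cut from its parent, which is then treated in the same way. -/
def cascade (h : FibHeap n K) (y : Fin n) : FibHeap n K :=
  match h.parent y with
  | none => { h with time := h.time + 1 }
  | some z =>
    if h.mark y = true then cascade (h.cut y z) z
    else { h with mark := Function.update h.mark y true, time := h.time + 1 }
termination_by (Finset.univ.filter fun x => h.mark x = true).card
decreasing_by
  rename_i hy
  apply Finset.card_lt_card
  refine (Finset.ssubset_iff_of_subset ?_).2
    ⟨y, Finset.mem_filter.2 ⟨Finset.mem_univ y, hy⟩, fun hmem => ?_⟩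
  · intro x hx
    by_cases hxy : x = y
    · exact Finset.mem_filter.2 ⟨Finset.mem_univ x, hxy ▸ hy⟩
    · have h1 := (Finset.mem_filter.1 hx).2
      simp only [cut, Function.update_of_ne hxy] at h1
      exact Finset.mem_filter.2 ⟨Finset.mem_univ x, h1⟩
  · have h1 := (Finset.mem_filter.1 hmem).2
    simp [cut] at h1

/-- Make `v` a root: cut it from its parent, if it has one, with cascading cuts above it. -/
def detach (h : FibHeap n K) (v : Fin n) : FibHeap n K :=
  match h.parent v with
  | none => { h with time := h.time + 1 }
  | some z => (h.cut v z).cascade z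

/-- Make `b` a child of `a`; both are roots. -/
def link (h : FibHeap n K) (a b : Fin n) : FibHeap n K :=
  { h with
    parent := Function.update h.parent b (some a)
    children := Function.update h.children a (b :: h.children a)
    mark := Function.update h.mark b false
    time := h.time + 1 }

/-- Increase the key of `v` to `k`, by deleting `v` and inserting it again: `v` becomes a root, its
children become roots, and `v` gets the new key. -/
def increaseKey (h : FibHeap n K) (v : Fin n) (k : WithTop K) : FibHeap n K :=
  let h' := h.detach v
  { key := Function.update h'.key v k
    parent := fun x => if x ∈ h'.children v then none else h'.parent x
    children := Function.update h'.children v []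
    mark := fun x => if x ∈ h'.children v then false else h'.mark x
    roots := h'.children v ++ h'.roots
    time := h'.time + 1 + (h'.children v).length }

variable [LinearOrder K]

/-- Decrease the key of `v` to `k`. -/
def decreaseKey (h : FibHeap n K) (v : Fin n) (k : WithTop K) : FibHeap n K :=
  let h' : FibHeap n K := { h with key := Function.update h.key v k, time := h.time + 1 }
  match h.parent v with
  | none => h'
  | some z => if k < h.key z then h'.detach v else h'

/-- Link roots of equal rank until there are no two of them. `slots` are the roots, of different
ranks, that have been treated so far; they are kept in a table indexed by rank, so that looking for
one of the same rank as `r` is one access to the table. -/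
def consolidate (h : FibHeap n K) : (pending slots : List (Fin n)) → FibHeap n K
  | [], slots => { h with roots := slots, time := h.time + 1 + slots.length }
  | r :: pending, slots =>
    match _hf : slots.find? fun y => (h.children y).length = (h.children r).length with
    | none => consolidate { h with time := h.time + 1 } pending (r :: slots)
    | some y =>
      if h.key r ≤ h.key y then consolidate (h.link r y) (r :: pending) (slots.erase y)
      else consolidate (h.link y r) (y :: pending) (slots.erase y)
termination_by pending slots => 2 * pending.length + slots.length
decreasing_by
  · simp only [List.length_cons]; omega
  all_goals
    have hy := List.mem_of_find?_eq_some _hf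
    have h1 := List.length_erase_of_mem hy
    have h2 := List.length_pos_of_mem hy
    simp only [List.length_cons]; omega

/-- Find a vertex of minimum key: link roots of equal rank, and search the remaining roots. -/
def findMin (h : FibHeap n K) : FibHeap n K × Option (Fin n) :=
  let h' := h.consolidate h.roots []
  ({ h' with time := h'.time + 1 + h'.roots.length }, h'.roots.argmin h'.key)

end FibHeap

/-! ### The algorithm -/

/-- The data of the algorithm. The graph is held in adjacency lists. The current tree `T` of paths
consists of `treeParent`, `treeChildren`; a vertex without tree parent hangs directly from the
artificial source, by an edge of cost zero that is not parameterized. All edges of the graph are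
parameterized, so that the path `t_w` to `w` in `T` has cost `dist w - lam * cnt w` at the value
`lam` of the parameter. `best v` is the tail of the edge that determines the key of `v` in the heap,
if that key is finite. `jumps w` counts the changes of the path to `w`. -/
structure State (n : ℕ) (K : Type*) where
  cost : Fin n × Fin n → K
  outNbrs : Fin n → List (Fin n)
  inNbrs : Fin n → List (Fin n)
  treeParent : Fin n → Option (Fin n)
  treeChildren : Fin n → List (Fin n)
  dist : Fin n → K
  cnt : Fin n → ℕ
  heap : FibHeap n K
  best : Fin n → Option (Fin n)
  halted : Bool
  /-- The value of the parameter at the last pivot point found. -/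
  lam : WithTop K
  /-- The minimum mean cycle, once it has been found, as the list of its vertices. -/
  cycle : Option (List (Fin n))
  jumps : Fin n → ℕ
  /-- The time spent so far outside the heap operations. -/
  time : ℕ

/-- Search from the vertices in `stack` along `children`, marking visited vertices. Returns the
list of the visited vertices and the time used. -/
def visit {n : ℕ} (children : Fin n → List (Fin n)) :
    (stack visited : List (Fin n)) → (time : ℕ) → List (Fin n) × ℕ
  | [], visited, time => (visited, time + 1)
  | x :: stack, visited, time =>
    if x ∈ visited then visit children stack visited (time + 1)
    else visit children (children x ++ stack) (x :: visited) (time + 1 + (children x).length)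
termination_by stack visited => ((Finset.univ \ visited.toFinset).card, stack.length)
decreasing_by
  · apply Prod.Lex.right; simp
  · rename_i hx
    apply Prod.Lex.left
    apply Finset.card_lt_card
    refine (Finset.ssubset_iff_of_subset ?_).2 ⟨x, by simpa using hx, by simp⟩
    intro y hy
    simp only [Finset.mem_sdiff, Finset.mem_univ, true_and, List.mem_toFinset, List.mem_cons,
      not_or] at hy ⊢
    exact hy.2

/-- Follow parent pointers from `x` to the ancestor `v`, for at most `fuel` vertices; the vertices
on the way are put in front of `acc`. -/
def climb {n : ℕ} (parent : Fin n → Option (Fin n)) (v : Fin n) :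
    (fuel : ℕ) → (x : Fin n) → (acc : List (Fin n)) → List (Fin n)
  | 0, _, acc => acc
  | fuel + 1, x, acc =>
    if x = v then x :: acc
    else match parent x with
      | none => x :: acc
      | some y => climb parent v fuel y (x :: acc)

namespace State

variable {n : ℕ} {K : Type*} [Field K] [LinearOrder K]

/-- The key of the edge `(u, v)`: the value of the parameter at which the path `t_u` followed by
`(u, v)` becomes as short as `t_v`, if the former has more parameterized edges; otherwise `⊤`. -/
def edgeKey (s : State n K) (u v : Fin n) : WithTop K :=
  if s.cnt v < s.cnt u + 1 then
    (((s.dist u + s.cost (u, v) - s.dist v) / ((s.cnt u : K) + 1 - (s.cnt v : K)) : K) : WithTop K)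
  else ⊤

/-- The minimum key of the edges that enter `w`, with the tail of an edge that attains it. -/
def scanIn (s : State n K) (w : Fin n) : WithTop K × Option (Fin n) :=
  (s.inNbrs w).foldl
    (fun b u => if s.edgeKey u w < b.1 then (s.edgeKey u w, some u) else b) (⊤, none)

/-- Compute the key of `w` from the edges that enter `w`, and insert `w` into the heap. -/
def insertVertex (s : State n K) (w : Fin n) : State n K :=
  { s with
    heap := s.heap.insert w (s.scanIn w).1
    best := Function.update s.best w (s.scanIn w).2
    time := s.time + 1 + (s.inNbrs w).length }

/-- Enter an edge into the adjacency lists. -/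
def addEdge (s : State n K) (e : Fin n × Fin n) : State n K :=
  { s with
    outNbrs := Function.update s.outNbrs e.1 (e.2 :: s.outNbrs e.1)
    inNbrs := Function.update s.inNbrs e.2 (e.1 :: s.inNbrs e.2)
    time := s.time + 1 }

/-- The memory before the edges are read. Every path in the first tree is the zero-cost edge from
the artificial source. The arrays are initialized in time `n`. -/
def blank (n : ℕ) (cost : Fin n × Fin n → K) : State n K where
  cost := cost
  outNbrs _ := []
  inNbrs _ := []
  treeParent _ := none
  treeChildren _ := []
  dist _ := 0
  cnt _ := 0
  heap := FibHeap.empty n K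
  best _ := none
  halted := false
  lam := ⊤
  cycle := none
  jumps _ := 0
  time := n

/-- Initialization: read the list of the edges, then build the heap. -/
def init (edges : List (Fin n × Fin n)) (cost : Fin n × Fin n → K) : State n K :=
  (List.finRange n).foldl insertVertex (edges.foldl addEdge (blank n cost))

/-- The tree without the edge into `v`, with the edge `(u, v)` instead, and the new paths to the
vertices in `sub`, the subtree of `v`. -/
def changePaths (s : State n K) (u v : Fin n) (sub : List (Fin n)) : State n K :=
  let cut : Fin n → List (Fin n) := match s.treeParent v with
    | none => s.treeChildren
    | some z => Function.update s.treeChildren z ((s.treeChildren z).erase v)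
  { s with
    treeParent := Function.update s.treeParent v (some u)
    treeChildren := Function.update cut u (v :: cut u)
    dist := fun w =>
      if w ∈ sub then s.dist w + (s.dist u + s.cost (u, v) - s.dist v) else s.dist w
    cnt := fun w => if w ∈ sub then s.cnt w + (s.cnt u + 1 - s.cnt v) else s.cnt w
    jumps := fun w => if w ∈ sub then s.jumps w + 1 else s.jumps w
    time := s.time + 1 + sub.length }

/-- Recompute the key of `w`, whose path has changed, from the edges that enter `w`. -/
def rekey (s : State n K) (w : Fin n) : State n K :=
  { s with
    heap := if (s.scanIn w).1 = s.heap.key w then s.heap else s.heap.increaseKey w (s.scanIn w).1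
    best := Function.update s.best w (s.scanIn w).2
    time := s.time + 1 + (s.inNbrs w).length }

/-- Decrease the key of `x` if the key of the edge `(w, x)` is less than it. -/
def relax (w : Fin n) (s : State n K) (x : Fin n) : State n K :=
  if s.edgeKey w x < s.heap.key x then
    { s with
      heap := s.heap.decreaseKey x (s.edgeKey w x)
      best := Function.update s.best x (some w)
      time := s.time + 1 }
  else { s with time := s.time + 1 }

/-- Check the edges that leave `w`, whose path has changed. -/
def relaxOut (s : State n K) (w : Fin n) : State n K :=
  (s.outNbrs w).foldl (relax w) { s with time := s.time + 1 }

/-- One round of the algorithm. Find a vertex `v` of minimum key. If its key is infinite, the graph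
has no cycle: stop. Otherwise let `(u, v)` be the edge that determines the key. If `u` lies in the
subtree of `v`, the tree path from `v` to `u` and the edge `(u, v)` form a minimum mean cycle:
stop. Otherwise make `u` the tree parent of `v`, and update the data of all vertices in the subtree
of `v`, which are the vertices whose path changes, and the keys. -/
def step (s : State n K) : State n K :=
  if s.halted then s
  else
    let f := s.heap.findMin
    let s := { s with heap := f.1, time := s.time + 1 }
    match f.2 with
    | none => { s with halted := true }
    | some v =>
      match s.best v with
      | none => { s with halted := true, lam := ⊤ }
      | some u =>
        let sub := visit s.treeChildren [v] [] 0
        let s := { s with lam := s.heap.key v, time := s.time + sub.2 }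
        if u ∈ sub.1 then
          let C := climb s.treeParent v n u []
          { s with halted := true, cycle := some C, time := s.time + C.length }
        else
          sub.1.foldl relaxOut (sub.1.foldl rekey (s.changePaths u v sub.1))

end State

/-- The number of shortest path changes, over all vertices, when the algorithm is run. -/
noncomputable def pathChanges {n : ℕ} (edges : List (Fin n × Fin n))
    (cost : Fin n × Fin n → ℝ) : ℕ∞ :=
  ⨆ k : ℕ, ((∑ w, (State.step^[k] (State.init edges cost)).jumps w : ℕ) : ℕ∞)

/-- The time that the algorithm takes until it halts. Every round before that takes at least one
unit of time, so this would be `⊤` if the algorithm did not halt. -/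
noncomputable def runningTime {n : ℕ} (edges : List (Fin n × Fin n))
    (cost : Fin n × Fin n → ℝ) : ℕ∞ :=
  ⨆ k : ℕ, (((State.step^[k] (State.init edges cost)).time
    + (State.step^[k] (State.init edges cost)).heap.time : ℕ) : ℕ∞)

/-- The random list `edges` lists, without repetition and in any order, the edges of a random
directed graph with vertices `0, …, n - 1` and `m` edges: each set of `m` of the `n (n - 1)` ordered
pairs of different vertices is the set of edges with the same probability. -/
structure IsRandomDigraph {Ω : Type*} [MeasurableSpace Ω] (μ : Measure Ω) (n m : ℕ)
    (edges : Ω → List (Fin n × Fin n)) : Prop where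
  measurableSet : ∀ l, MeasurableSet {ω | edges ω = l}
  nodup : ∀ ω, (edges ω).Nodup
  length : ∀ ω, (edges ω).length = m
  loopless : ∀ ω, ∀ e ∈ edges ω, e.1 ≠ e.2
  uniform : ∀ E : Finset (Fin n × Fin n), E.card = m → (∀ e ∈ E, e.1 ≠ e.2) →
    μ {ω | (edges ω).toFinset = E} = ((n * (n - 1)).choose m : ℝ≥0∞)⁻¹

end ParametricPath

/-! The proof combines an amortized analysis, valid for every graph, with a tail bound for the
degrees of the random one.

For the heap, the potential is twice the number of roots plus three times the number of marked
nodes. Ranks are at most `FibHeap.maxRank n`, of order log n, by the usual Fibonacci argument. Hence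
decreasing a key has constant amortized cost, while finding the minimum and increasing a key cost
O(log n).

Suppose that all in- and out-degrees are at most `D`. A changed path then costs O(log n + D), for
one increase of a key and a scan of the edges at the vertex. Every round except the last changes at
least the path to `v`, so its fixed cost is charged to that change. This gives R ≤ O(m + n) + O(log
n + D) J (`runningTime_le`). Optimality of the keys plays no role here; the only fact needed about
the stored edge (u, v) is δ(t_v) ≤ δ(t_u). It makes every path change raise δ of each affected
vertex, and δ is the depth in a forest on n vertices, so J ≤ n² always (`pathChanges_le`).

It remains to replace `D`, which may be correlated with J because the costs are arbitrary. Let Y be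
the sum over all vertices of 2^outdegree + 2^indegree. Then log₂ Y bounds all degrees, and E(Y) ≤ 2n
exp(m/n) (`IsRandomDigraph.lintegral_degreeExpSum_le`). With a deterministic threshold T of order
m/n + log n, degrees up to T contribute O(log n + T) E(J), which is O(m + n log n) when E(J) ≤ C n.
The excess of log₂ Y over T is at most Y / 2^T; even when multiplied by the worst case J ≤ n², it
contributes only a constant in expectation, since 2^T ≥ n³ exp(m/n). No independence of J and the
degrees is needed. -/

namespace ParametricPath

/-! ### Amortized analysis of Fibonacci heaps -/

namespace FibHeap

/-- Every member of the list has weight at least the number of the members behind it. -/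
def RankOrdered {α : Type*} (w : α → ℕ) : List α → Prop
  | [] => True
  | c :: t => t.length ≤ w c ∧ RankOrdered w t

theorem RankOrdered.mono {α : Type*} {w w' : α → ℕ} {l : List α} (h : RankOrdered w l)
    (hw : ∀ c ∈ l, w c ≤ w' c) : RankOrdered w' l := by
  induction l with
  | nil => trivial
  | cons c t ih =>
    exact ⟨h.1.trans (hw c (by simp)), ih h.2 fun x hx => hw x (by simp [hx])⟩

/-- Removing a member can only shorten what lies behind the others. This is why the order survives
the loss of siblings. -/
theorem RankOrdered.erase {α : Type*} [DecidableEq α] {w : α → ℕ} {l : List α}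
    (h : RankOrdered w l) (v : α) : RankOrdered w (l.erase v) := by
  induction l with
  | nil => trivial
  | cons c t ih =>
    rw [List.erase_cons]
    split_ifs
    · exact h.2
    · exact ⟨(List.length_erase_le).trans h.1, ih h.2⟩

/-- If the value of `g` at an item of weight `k` is at least `fib (k + 1)`, then the sum of `g` over
a rank-ordered list is at least a Fibonacci number. -/
theorem RankOrdered.fib_le_sum {α : Type*} {w g : α → ℕ} {l : List α} (h : RankOrdered w l)
    (hg : ∀ c ∈ l, Nat.fib (w c + 1) ≤ g c) : Nat.fib (l.length + 2) ≤ 1 + (l.map g).sum := by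
  induction l with
  | nil => simp
  | cons c t ih =>
    have h1 := ih h.2 fun x hx => hg x (by simp [hx])
    have h2 := hg c (by simp)
    have h3 : Nat.fib (t.length + 1) ≤ Nat.fib (w c + 1) := Nat.fib_mono (by have := h.1; omega)
    have h4 : Nat.fib (t.length + 1 + 2) = Nat.fib (t.length + 1) + Nat.fib (t.length + 1 + 1) :=
      Nat.fib_add_two
    simp only [List.length_cons, List.map_cons, List.sum_cons]
    have h5 : t.length + 1 + 1 = t.length + 2 := rfl
    rw [h5] at h4
    omega

variable {n : ℕ} {K : Type*}

/-- The bound on the rank of `c` that the mark of `c` guarantees, with an additional slack `d`. -/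
def weight (h : FibHeap n K) (d : Fin n → ℕ) (c : Fin n) : ℕ :=
  (h.children c).length + (if h.mark c = true then 1 else 0) + d c

/-- The structural invariants of a Fibonacci heap, where the vertex `c` may have lost `d c`
children that its mark does not account for. -/
structure WFWith (h : FibHeap n K) (d : Fin n → ℕ) : Prop where
  mem_children : ∀ a b, b ∈ h.children a ↔ h.parent b = some a
  nodup_children : ∀ a, (h.children a).Nodup
  nodup_roots : h.roots.Nodup
  parent_of_mem_roots : ∀ x ∈ h.roots, h.parent x = none
  acyclic : ∃ ht : Fin n → ℕ, ∀ a b, h.parent b = some a → ht b < ht a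
  ranked : ∀ a, RankOrdered (h.weight d) (h.children a)

/-- The structural invariants of a Fibonacci heap. -/
def WF (h : FibHeap n K) : Prop := h.WFWith 0

/-- The number of marked vertices. -/
def marked (h : FibHeap n K) : ℕ := (Finset.univ.filter fun x => h.mark x = true).card

/-- The time spent so far, and the potential of the heap. -/
def charge (h : FibHeap n K) : ℕ := h.time + 2 * h.roots.length + 3 * h.marked

/-- A bound on the ranks in Fibonacci heaps with `n` items. -/
def maxRank (n : ℕ) : ℕ := 2 * Nat.log 2 n + 1

theorem two_pow_half_le_fib (k : ℕ) : 2 ^ (k / 2) ≤ Nat.fib (k + 2) := by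
  induction k using Nat.twoStepInduction with
  | zero => simp
  | one => decide
  | more k ih _ =>
    have h1 : (k + 2) / 2 = k / 2 + 1 := by omega
    have h2 : Nat.fib (k + 2 + 2) = Nat.fib (k + 2) + Nat.fib (k + 2 + 1) := Nat.fib_add_two
    have h3 : Nat.fib (k + 2) ≤ Nat.fib (k + 2 + 1) := Nat.fib_le_fib_succ
    rw [h1, pow_succ]
    omega

open Classical in
/-- The vertices of the subtree of `x`. -/
noncomputable def descendants (h : FibHeap n K) (x : Fin n) : Finset (Fin n) :=
  Finset.univ.filter fun y => Relation.ReflTransGen (fun b a => h.parent b = some a) y x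

theorem mem_descendants {h : FibHeap n K} {x y : Fin n} :
    y ∈ h.descendants x ↔ Relation.ReflTransGen (fun b a => h.parent b = some a) y x := by
  simp [descendants]

theorem le_of_reflTransGen {h : FibHeap n K} {ht : Fin n → ℕ}
    (hht : ∀ a b, h.parent b = some a → ht b < ht a) {x y : Fin n}
    (hxy : Relation.ReflTransGen (fun b a => h.parent b = some a) y x) : ht y ≤ ht x := by
  induction hxy with
  | refl => rfl
  | tail _ hbc ih => exact ih.trans (hht _ _ hbc).le

theorem eq_of_mem_descendants {h : FibHeap n K} {ht : Fin n → ℕ}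
    (hht : ∀ a b, h.parent b = some a → ht b < ht a) {a b c : Fin n}
    (hb : h.parent b = some a) (hc : h.parent c = some a)
    (hbc : Relation.ReflTransGen (fun b a => h.parent b = some a) b c) : b = c := by
  rcases Relation.ReflTransGen.cases_head hbc with h1 | ⟨d, h1, h2⟩
  · exact h1
  · rw [hb, Option.some_inj] at h1
    subst h1
    exact absurd (le_of_reflTransGen hht h2) (not_le.2 (hht _ _ hc))

/-- Subtrees of different children are disjoint: two ancestors of one vertex are comparable, since
parents are unique, and comparable siblings coincide because heights strictly increase towards the
root. -/
theorem sum_card_descendants_le {h : FibHeap n K} (hw : h.WF) (x : Fin n) :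
    1 + ((h.children x).map fun c => (h.descendants c).card).sum ≤ (h.descendants x).card := by
  classical
  obtain ⟨ht, hht⟩ := hw.acyclic
  rw [← List.sum_toFinset _ (hw.nodup_children x), ← Finset.card_biUnion, add_comm,
    ← Finset.card_insert_of_notMem (a := x)]
  · apply Finset.card_le_card
    intro y hy
    rw [Finset.mem_insert, Finset.mem_biUnion] at hy
    rw [mem_descendants]
    rcases hy with rfl | ⟨c, hc, hy⟩
    · exact Relation.ReflTransGen.refl
    · rw [List.mem_toFinset, hw.mem_children] at hc
      exact (mem_descendants.1 hy).tail hc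
  · intro hx
    obtain ⟨c, hc, hx⟩ := Finset.mem_biUnion.1 hx
    rw [List.mem_toFinset, hw.mem_children] at hc
    exact absurd (le_of_reflTransGen hht (mem_descendants.1 hx)) (not_le.2 (hht _ _ hc))
  · intro b hb c hc hne
    rw [Finset.mem_coe, List.mem_toFinset, hw.mem_children] at hb hc
    refine Finset.disjoint_left.2 fun y hyb hyc => hne ?_
    have hu : Relator.RightUnique fun b a => h.parent b = some a := by
      intro p q r hq hr
      exact Option.some_inj.1 (hq.symm.trans hr)
    rcases Relation.ReflTransGen.total_of_right_unique hu (mem_descendants.1 hyb)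
      (mem_descendants.1 hyc) with h1 | h1
    · exact eq_of_mem_descendants hht hb hc h1
    · exact (eq_of_mem_descendants hht hc hb h1).symm

/-- Induction on the height. The mark adds at most one to the weight of a child, so a child of
weight k has rank at least k - 1, and by induction at least `fib (k + 1)` descendants, as
`RankOrdered.fib_le_sum` requires. -/
theorem fib_le_card_descendants {h : FibHeap n K} (hw : h.WF) (x : Fin n) :
    Nat.fib ((h.children x).length + 2) ≤ (h.descendants x).card := by
  obtain ⟨ht, hht⟩ := hw.acyclic
  induction hk : ht x using Nat.strong_induction_on generalizing x with
  | _ k ih =>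
    refine le_trans ((hw.ranked x).fib_le_sum fun c hc => ?_) (sum_card_descendants_le hw x)
    refine le_trans (Nat.fib_mono ?_)
      (ih (ht c) (hk ▸ hht _ _ ((hw.mem_children x c).1 hc)) c rfl)
    simp only [weight, Pi.zero_apply]
    split_ifs <;> omega

/-- Ranks in a Fibonacci heap are logarithmic. -/
theorem WF.length_children_le {h : FibHeap n K} (hw : h.WF) (x : Fin n) :
    (h.children x).length ≤ maxRank n := by
  have h1 := (two_pow_half_le_fib _).trans ((fib_le_card_descendants hw x).trans
    (Finset.card_le_univ _))
  rw [Fintype.card_fin] at h1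
  have h2 := Nat.le_log_of_pow_le (by norm_num) h1
  unfold maxRank
  omega

theorem wf_empty : (empty n K).WF where
  mem_children := by simp [empty]
  nodup_children := by simp [empty]
  nodup_roots := by simp [empty]
  parent_of_mem_roots := by simp [empty]
  acyclic := ⟨0, by simp [empty]⟩
  ranked _ := trivial

theorem WF.insert {h : FibHeap n K} (hw : h.WF) {v : Fin n} (k : WithTop K)
    (hp : h.parent v = none) (hv : v ∉ h.roots) : (h.insert v k).WF where
  mem_children := hw.mem_children
  nodup_children := hw.nodup_children
  nodup_roots := List.nodup_cons.2 ⟨hv, hw.nodup_roots⟩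
  parent_of_mem_roots x hx := by
    rcases List.mem_cons.1 hx with rfl | hx
    · exact hp
    · exact hw.parent_of_mem_roots x hx
  acyclic := hw.acyclic
  ranked := hw.ranked

theorem charge_insert (h : FibHeap n K) (v : Fin n) (k : WithTop K) :
    (h.insert v k).charge = h.charge + 3 := by
  have h1 : (h.insert v k).marked = h.marked := rfl
  simp only [charge, h1]
  simp only [insert, List.length_cons]
  omega

/-- Cutting a vertex transfers the slack from it to its former parent. -/
theorem WFWith.cut {h : FibHeap n K} {d : Fin n → ℕ} (hw : h.WFWith d) {v z : Fin n}
    (hd : ∀ c, c ≠ v → d c = 0) (hp : h.parent v = some z) :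
    (h.cut v z).WFWith (Pi.single z 1) where
  mem_children a b := by
    simp only [FibHeap.cut]
    by_cases ha : a = z
    · subst ha
      rw [Function.update_self, (hw.nodup_children a).mem_erase_iff, hw.mem_children]
      by_cases hb : b = v
      · subst hb; simp
      · simp [hb]
    · rw [Function.update_of_ne ha, hw.mem_children]
      by_cases hb : b = v
      · subst hb
        rw [hp]
        simpa using fun h => ha h.symm
      · simp [hb]
  nodup_children a := by
    simp only [FibHeap.cut]
    by_cases ha : a = z
    · subst ha
      simpa using (hw.nodup_children a).erase v
    · simpa [ha] using hw.nodup_children a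
  nodup_roots := by
    refine List.nodup_cons.2 ⟨fun hv => ?_, hw.nodup_roots⟩
    simp [hw.parent_of_mem_roots v hv] at hp
  parent_of_mem_roots x hx := by
    simp only [FibHeap.cut] at hx ⊢
    by_cases hv : x = v
    · subst hv; simp
    · simpa [hv] using hw.parent_of_mem_roots x (by simpa [hv] using hx)
  acyclic := by
    obtain ⟨ht, hht⟩ := hw.acyclic
    refine ⟨ht, fun a b hb => hht a b ?_⟩
    simp only [FibHeap.cut] at hb
    by_cases hv : b = v
    · subst hv; simp at hb
    · simpa [hv] using hb
  ranked a := by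
    -- Only `z` loses a child, and its new unit of slack makes up for it. The slack of `v` may be
    -- dropped because `v` is no longer in any list of children.
    have hwt : ∀ c, c ≠ v → h.weight d c ≤ (h.cut v z).weight (Pi.single z 1) c := by
      intro c hc
      simp only [weight, hd c hc, FibHeap.cut, Function.update_of_ne hc]
      by_cases hcz : c = z
      · subst hcz
        have h1 : v ∈ h.children c := (hw.mem_children c v).2 hp
        have h2 := List.length_erase_of_mem h1
        have h3 := List.length_pos_of_mem h1
        simp only [Function.update_self, Pi.single_eq_same]
        omega
      · simp [hcz]
    by_cases ha : a = z
    · subst ha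
      have h1 : (h.cut v a).children a = (h.children a).erase v := by simp [FibHeap.cut]
      rw [h1]
      refine ((hw.ranked a).erase v).mono fun c hc => hwt c ?_
      exact ((hw.nodup_children a).mem_erase_iff.1 hc).1
    · have h1 : (h.cut v z).children a = h.children a := by simp [FibHeap.cut, ha]
      rw [h1]
      refine (hw.ranked a).mono fun c hc => hwt c ?_
      rintro rfl
      rw [hw.mem_children, hp, Option.some_inj] at hc
      exact ha hc.symm

theorem marked_le_of_imp {g h : FibHeap n K} (hgh : ∀ x, g.mark x = true → h.mark x = true) :
    g.marked ≤ h.marked :=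
  Finset.card_le_card fun x hx =>
    Finset.mem_filter.2 ⟨Finset.mem_univ x, hgh x (Finset.mem_filter.1 hx).2⟩

theorem mark_cut {h : FibHeap n K} {v z x : Fin n} (hx : (h.cut v z).mark x = true) :
    x ≠ v ∧ h.mark x = true := by
  simp only [cut] at hx
  by_cases hv : x = v
  · subst hv; simp at hx
  · exact ⟨hv, by simpa [hv] using hx⟩

theorem marked_cut_le (h : FibHeap n K) (v z : Fin n) : (h.cut v z).marked ≤ h.marked :=
  marked_le_of_imp fun _ hx => (mark_cut hx).2

theorem marked_cut_lt {h : FibHeap n K} {v : Fin n} (hv : h.mark v = true) (z : Fin n) :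
    (h.cut v z).marked < h.marked :=
  Finset.card_lt_card ((Finset.ssubset_iff_of_subset fun x hx => Finset.mem_filter.2
    ⟨Finset.mem_univ x, (mark_cut (Finset.mem_filter.1 hx).2).2⟩).2
    ⟨v, Finset.mem_filter.2 ⟨Finset.mem_univ v, hv⟩,
      fun hx => (mark_cut (Finset.mem_filter.1 hx).2).1 rfl⟩)

/-- The slack of `y` is disposed of in three ways: at a root it is irrelevant, because a root is in
no list of children; at an unmarked node the new mark takes its place; at a marked node a cut passes
it on to the parent. The constant 4 is one unit of time and the potential 3 of a new mark. -/
theorem WFWith.cascade {h : FibHeap n K} {y : Fin n} (hw : h.WFWith (Pi.single y 1)) :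
    (h.cascade y).WF ∧ (h.cascade y).charge ≤ h.charge + 4 ∧
      ∀ x, h.parent x = none → (h.cascade y).parent x = none := by
  induction h, y using FibHeap.cascade.induct with
  | case1 h y hp =>
    rw [FibHeap.cascade, hp]
    refine ⟨⟨hw.mem_children, hw.nodup_children, hw.nodup_roots, hw.parent_of_mem_roots,
      hw.acyclic, fun a => (hw.ranked a).mono fun c hc => ?_⟩, ?_, fun x hx => hx⟩
    · have hc' := (hw.mem_children a c).1 hc
      have hne : c ≠ y := by rintro rfl; simp [hp] at hc'
      simp [weight, hne]
    · simp only [charge, marked]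
      omega
  | case2 h y z hp hm ih =>
    obtain ⟨h1, h2, h3⟩ := ih (hw.cut (fun c hc => by simp [hc]) hp)
    rw [FibHeap.cascade, hp]
    simp only [hm, if_true]
    refine ⟨h1, h2.trans ?_, fun x hx => h3 x ?_⟩
    -- A cascading cut is free: the lost mark releases 3, which pays for one unit of time and the
    -- potential 2 of the new root.
    · have h4 := marked_cut_lt hm z
      simp only [charge] at h4 ⊢
      simp only [FibHeap.cut, List.length_cons] at h4 ⊢
      omega
    · by_cases hxy : x = y
      · subst hxy; simp [FibHeap.cut]
      · simpa [FibHeap.cut, hxy] using hx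
  | case3 h y z hp hm =>
    rw [FibHeap.cascade, hp]
    simp only [hm]
    refine ⟨⟨hw.mem_children, hw.nodup_children, hw.nodup_roots, hw.parent_of_mem_roots,
      hw.acyclic, fun a => (hw.ranked a).mono fun c hc => ?_⟩, ?_, fun x hx => hx⟩
    · by_cases hcy : c = y
      · subst hcy; simp [weight, hm]
      · simp [weight, hcy]
    · have h1 : (Finset.univ.filter fun x => Function.update h.mark y true x = true).card
          ≤ h.marked + 1 := by
        refine le_trans (Finset.card_le_card fun x hx => ?_) (Finset.card_insert_le y _)
        simp only [Finset.mem_filter, Finset.mem_univ, true_and, Finset.mem_insert] at hx ⊢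
        by_cases hxy : x = y
        · exact Or.inl hxy
        · exact Or.inr (by simpa [hxy] using hx)
      simp only [charge, marked] at h1 ⊢
      simp only [Bool.false_eq_true, if_false]
      omega

/-- The first cut costs 3, for its time and the new root, and the cascade above it costs 4. -/
theorem WF.detach {h : FibHeap n K} (hw : h.WF) (v : Fin n) :
    (h.detach v).WF ∧ (h.detach v).charge ≤ h.charge + 7 ∧ (h.detach v).parent v = none := by
  unfold FibHeap.detach
  split
  · rename_i hp
    exact ⟨⟨hw.mem_children, hw.nodup_children, hw.nodup_roots, hw.parent_of_mem_roots,
      hw.acyclic, hw.ranked⟩, by simp only [charge, marked]; omega, hp⟩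
  · rename_i z hp
    obtain ⟨h1, h2, h3⟩ := (WFWith.cut hw (fun _ _ => rfl) hp).cascade
    refine ⟨h1, h2.trans ?_, h3 v (by simp [FibHeap.cut])⟩
    have h4 := marked_cut_le h v z
    simp only [charge] at h4 ⊢
    simp only [FibHeap.cut, List.length_cons] at h4 ⊢
    omega

/-- Beyond `detach`, each child of `v` costs 3: one unit of time and the potential 2 of a new root.
The rank bound limits their number. -/
theorem WF.increaseKey {h : FibHeap n K} (hw : h.WF) (v : Fin n) (k : WithTop K) :
    (h.increaseKey v k).WF ∧ (h.increaseKey v k).charge ≤ h.charge + 8 + 3 * maxRank n := by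
  obtain ⟨h1, h2, h3⟩ := hw.detach v
  set g := h.detach v with hg
  have hr := h1.length_children_le v
  constructor
  · refine ⟨fun a b => ?_, fun a => ?_, ?_, fun x hx => ?_, ?_, fun a => ?_⟩
    · simp only [FibHeap.increaseKey, ← hg]
      by_cases ha : a = v
      · subst ha
        by_cases hb : b ∈ g.children a
        · simp [hb]
        · simpa [hb] using fun h => hb ((h1.mem_children a b).2 h)
      · rw [Function.update_of_ne ha, h1.mem_children]
        split_ifs with hb
        · rw [(h1.mem_children _ _).1 hb]
          simpa using fun h => ha h.symm
        · rfl
    · simp only [FibHeap.increaseKey, ← hg]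
      by_cases ha : a = v
      · subst ha; simp
      · simpa [ha] using h1.nodup_children a
    · refine List.Nodup.append (h1.nodup_children v) h1.nodup_roots fun x hx hx' => ?_
      have h4 := (h1.mem_children _ _).1 hx
      rw [h1.parent_of_mem_roots x hx'] at h4
      simp at h4
    · simp only [FibHeap.increaseKey, ← hg, List.mem_append] at hx ⊢
      split_ifs with hc
      · rfl
      · exact h1.parent_of_mem_roots x (hx.resolve_left hc)
    · obtain ⟨ht, hht⟩ := h1.acyclic
      refine ⟨ht, fun a b hb => hht a b ?_⟩
      simp only [FibHeap.increaseKey, ← hg] at hb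
      split_ifs at hb
      exact hb
    · by_cases ha : a = v
      · subst ha
        have h4 : (h.increaseKey a k).children a = [] := by simp [FibHeap.increaseKey]
        rw [h4]
        trivial
      · have h4 : (h.increaseKey v k).children a = g.children a := by
          simp [FibHeap.increaseKey, ← hg, ha]
        rw [h4]
        refine (h1.ranked a).mono fun c hc => ?_
        rw [h1.mem_children] at hc
        have hcv : c ≠ v := by rintro rfl; simp [h3] at hc
        have hc' : c ∉ g.children v := by
          rw [h1.mem_children, hc, Option.some_inj]
          exact ha
        simp [weight, FibHeap.increaseKey, ← hg, hcv, hc']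
  · have hm : (h.increaseKey v k).marked ≤ g.marked := by
      refine marked_le_of_imp fun x hx => ?_
      simp only [FibHeap.increaseKey, ← hg] at hx
      split_ifs at hx
      exact hx
    have ht : (h.increaseKey v k).time = g.time + 1 + (g.children v).length := rfl
    have hl : (h.increaseKey v k).roots.length = (g.children v).length + g.roots.length := by
      simp [FibHeap.increaseKey, ← hg]
    simp only [charge] at h2 ⊢
    rw [ht, hl]
    omega

/-- Linking two roots of equal rank. -/
theorem WF.link {h : FibHeap n K} (hw : h.WF) {a b : Fin n} (hab : a ≠ b)
    (ha : h.parent a = none) (hb : h.parent b = none)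
    (hr : (h.children b).length = (h.children a).length) {l : List (Fin n)} (hl : l.Nodup)
    (hlb : b ∉ l) (hlp : ∀ x ∈ l, h.parent x = none) :
    ({ h.link a b with roots := l } : FibHeap n K).WF where
  mem_children c x := by
    simp only [FibHeap.link]
    by_cases hx : x = b
    · subst hx
      by_cases hc : c = a
      · subst hc; simp
      · simp only [Function.update_of_ne hc, Function.update_self, hw.mem_children, hb,
          Option.some_inj]
        simpa using fun h => hc h.symm
    · by_cases hc : c = a
      · subst hc; simp [hx, hw.mem_children]
      · simp [hx, hc, hw.mem_children]
  nodup_children c := by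
    simp only [FibHeap.link]
    by_cases hc : c = a
    · subst hc
      simpa [hw.mem_children, hb] using hw.nodup_children c
    · simpa [hc] using hw.nodup_children c
  nodup_roots := hl
  parent_of_mem_roots x hx := by
    have hxb : x ≠ b := fun h => hlb (h ▸ hx)
    simpa [FibHeap.link, hxb] using hlp x hx
  acyclic := by
    obtain ⟨ht, hht⟩ := hw.acyclic
    -- Raising the height of `a` violates nothing above it, since `a` is a root.
    refine ⟨Function.update ht a (ht a + ht b + 1), fun c x hx => ?_⟩
    simp only [FibHeap.link] at hx
    by_cases hxb : x = b
    · subst hxb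
      simp only [Function.update_self, Option.some_inj] at hx
      subst hx
      rw [Function.update_of_ne hab.symm, Function.update_self]
      omega
    · rw [Function.update_of_ne hxb] at hx
      have hxa : x ≠ a := by rintro rfl; simp [ha] at hx
      have h1 := hht c x hx
      rw [Function.update_of_ne hxa]
      by_cases hc : c = a
      · subst hc
        rw [Function.update_self]
        omega
      · rwa [Function.update_of_ne hc]
  ranked c := by
    have hwt : ∀ x, x ≠ b →
        h.weight 0 x ≤ ({ h.link a b with roots := l } : FibHeap n K).weight 0 x := by
      intro x hx
      simp only [weight, FibHeap.link, Function.update_of_ne hx]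
      by_cases hxa : x = a
      · subst hxa; simp
      · simp [hxa]
    have hmem : ∀ x ∈ h.children c, x ≠ b := by
      rintro x hx rfl
      simp [hw.mem_children, hb] at hx
    by_cases hc : c = a
    · subst hc
      simp only [FibHeap.link, Function.update_self]
      -- The new child goes to the front of the list. Its rank equals the former rank of its parent,
      -- which is the number of children now behind it.
      refine ⟨?_, (hw.ranked c).mono fun x hx => hwt x (hmem x hx)⟩
      simp only [weight, Function.update_of_ne hab.symm, hr]
      omega
    · have h1 : ({ h.link a b with roots := l } : FibHeap n K).children c = h.children c := by
        simp [FibHeap.link, hc]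
      rw [h1]
      exact (hw.ranked c).mono fun x hx => hwt x (hmem x hx)

theorem marked_link_le (h : FibHeap n K) (a b : Fin n) : (h.link a b).marked ≤ h.marked := by
  refine marked_le_of_imp fun x hx => ?_
  simp only [FibHeap.link] at hx
  by_cases hv : x = b
  · subst hv; simp at hx
  · simpa [hv] using hx

/-- The step of consolidation that links the root `r` and the slot `y`. -/
theorem WF.link_slot {h : FibHeap n K} {pending slots : List (Fin n)} {r y : Fin n}
    (hw : ({ h with roots := r :: pending ++ slots } : FibHeap n K).WF)
    (hs : slots.Pairwise fun x y => (h.children x).length ≠ (h.children y).length)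
    (hy : y ∈ slots) (hry : (h.children y).length = (h.children r).length) {a b : Fin n}
    (hab : a = r ∧ b = y ∨ a = y ∧ b = r) :
    ({ h.link a b with roots := a :: pending ++ slots.erase y } : FibHeap n K).WF ∧
      (slots.erase y).Pairwise fun x z =>
        ((h.link a b).children x).length ≠ ((h.link a b).children z).length := by
  have hn : (r :: pending ++ slots).Nodup := hw.nodup_roots
  have hp : ∀ x ∈ r :: pending ++ slots, h.parent x = none := hw.parent_of_mem_roots
  have hne : ∀ x ∈ slots, x ≠ r := by
    rintro x hx rfl
    simp [hx] at hn
  have hns : slots.Nodup := (List.nodup_append.1 hn).2.1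
  have hperm : (y :: (r :: pending ++ slots.erase y)).Perm (r :: pending ++ slots) :=
    List.perm_middle.symm.trans ((List.perm_cons_erase hy).symm.append_left _)
  have hn' := hperm.nodup_iff.2 hn
  have hp' : ∀ x ∈ y :: (r :: pending ++ slots.erase y), h.parent x = none :=
    fun x hx => hp x (hperm.mem_iff.1 hx)
  have hyr := hne y hy
  constructor
  · rcases hab with ⟨rfl, rfl⟩ | ⟨rfl, rfl⟩
    · refine WF.link (h := { h with roots := _ }) hw hyr.symm (hp' a (by simp)) (hp' b (by simp))
        hry (List.nodup_cons.1 hn').2 (List.nodup_cons.1 hn').1 fun x hx => hp' x ?_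
      exact List.mem_cons_of_mem _ hx
    · simp only [List.cons_append, List.nodup_cons, List.mem_cons, not_or] at hn'
      refine WF.link (h := { h with roots := _ }) hw hyr (hp' a (by simp)) (hp' b (by simp))
        hry.symm (List.nodup_cons.2 ⟨hn'.1.2, hn'.2.2⟩) ?_ fun x hx => hp' x ?_
      · rw [List.cons_append, List.mem_cons, not_or]
        exact ⟨hyr.symm, hn'.2.1⟩
      · simp only [List.cons_append, List.mem_cons] at hx ⊢
        tauto
  · refine (hs.sublist List.erase_sublist).imp_of_mem fun {x z} hx hz hxz => ?_
    have hc : ∀ x ∈ slots.erase y, (h.link a b).children x = h.children x := by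
      intro x hx
      rw [hns.mem_erase_iff] at hx
      refine Function.update_of_ne ?_ _ _
      rcases hab with ⟨rfl, rfl⟩ | ⟨rfl, rfl⟩
      · exact hne x hx.2
      · exact hx.1
    rwa [hc x hx, hc z hz]

variable [LinearOrder K]

theorem WF.decreaseKey {h : FibHeap n K} (hw : h.WF) (v : Fin n) (k : WithTop K) :
    (h.decreaseKey v k).WF ∧ (h.decreaseKey v k).charge ≤ h.charge + 8 := by
  set g : FibHeap n K := { h with key := Function.update h.key v k, time := h.time + 1 } with hg
  have h1 : g.WF := ⟨hw.mem_children, hw.nodup_children, hw.nodup_roots, hw.parent_of_mem_roots,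
      hw.acyclic, hw.ranked⟩
  have h2 : g.charge = h.charge + 1 := by
    simp only [charge, hg, marked]
    omega
  unfold FibHeap.decreaseKey
  simp only [← hg]
  split
  · exact ⟨h1, by omega⟩
  · split_ifs
    · have h3 := h1.detach v
      exact ⟨h3.1, by have := h3.2.1; omega⟩
    · exact ⟨h1, by omega⟩

/-- The roots are represented by `pending ++ slots`. Each unit of time lowers `2 * pending.length +
slots.length` by one, whether a root moves from `pending` to `slots` or two roots are linked; this
gives the exact time. The ranks in `slots` stay different because the root whose rank grows returns
to `pending`. -/
theorem WF.consolidate {h : FibHeap n K} {pending slots : List (Fin n)}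
    (hw : ({ h with roots := pending ++ slots } : FibHeap n K).WF)
    (hs : slots.Pairwise fun x y => (h.children x).length ≠ (h.children y).length) :
    (h.consolidate pending slots).WF ∧
      ((h.consolidate pending slots).roots.Pairwise fun x y =>
        ((h.consolidate pending slots).children x).length
          ≠ ((h.consolidate pending slots).children y).length) ∧
      (h.consolidate pending slots).time = h.time + 2 * pending.length + slots.length + 1 ∧
      (h.consolidate pending slots).marked ≤ h.marked := by
  induction h, pending, slots using FibHeap.consolidate.induct with
  | case1 h slots =>
    rw [FibHeap.consolidate]
    refine ⟨⟨hw.mem_children, hw.nodup_children, hw.nodup_roots, hw.parent_of_mem_roots,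
      hw.acyclic, hw.ranked⟩, hs, by simp; omega, le_rfl⟩
  | case2 h r pending slots hf ih =>
    have hperm : (pending ++ r :: slots).Perm (r :: pending ++ slots) := List.perm_middle
    have h1 := ih ⟨hw.mem_children, hw.nodup_children, hperm.nodup_iff.2 hw.nodup_roots,
      fun x hx => hw.parent_of_mem_roots x (hperm.mem_iff.1 hx), hw.acyclic, hw.ranked⟩
      (List.pairwise_cons.2 ⟨fun y hy he => by simpa [he] using List.find?_eq_none.1 hf y hy, hs⟩)
    rw [FibHeap.consolidate]
    split
    · refine ⟨h1.1, h1.2.1, h1.2.2.1.trans ?_, h1.2.2.2⟩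
      simp only [List.length_cons]
      omega
    · simp_all
  | case3 h r pending slots y hf hk ih =>
    have hy := List.mem_of_find?_eq_some hf
    have hry : (h.children y).length = (h.children r).length := by
      simpa using List.find?_some hf
    have h2 := hw.link_slot hs hy hry (Or.inl ⟨rfl, rfl⟩)
    have h1 := ih h2.1 h2.2
    rw [FibHeap.consolidate]
    split
    · simp_all
    · rename_i y' hf'
      obtain rfl : y = y' := Option.some_inj.1 (hf.symm.trans hf')
      rw [if_pos hk]
      refine ⟨h1.1, h1.2.1, h1.2.2.1.trans ?_, h1.2.2.2.trans (marked_link_le _ _ _)⟩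
      have h3 := List.length_erase_of_mem hy
      have h4 := List.length_pos_of_mem hy
      simp only [FibHeap.link, List.length_cons]
      omega
  | case4 h r pending slots y hf hk ih =>
    have hy := List.mem_of_find?_eq_some hf
    have hry : (h.children y).length = (h.children r).length := by
      simpa using List.find?_some hf
    have h2 := hw.link_slot hs hy hry (Or.inr ⟨rfl, rfl⟩)
    have h1 := ih h2.1 h2.2
    rw [FibHeap.consolidate]
    split
    · simp_all
    · rename_i y' hf'
      obtain rfl : y = y' := Option.some_inj.1 (hf.symm.trans hf')
      rw [if_neg hk]
      refine ⟨h1.1, h1.2.1, h1.2.2.1.trans ?_, h1.2.2.2.trans (marked_link_le _ _ _)⟩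
      have h3 := List.length_erase_of_mem hy
      have h4 := List.length_pos_of_mem hy
      simp only [FibHeap.link, List.length_cons]
      omega

/-- The potential 2 of each old root pays for consolidation. The remaining roots have different
ranks, so there are at most `maxRank n + 1` of them, each costing 3: its potential and one unit for
the search of the minimum. -/
theorem WF.findMin {h : FibHeap n K} (hw : h.WF) :
    h.findMin.1.WF ∧ h.findMin.1.charge ≤ h.charge + 3 * maxRank n + 5 := by
  have h0 : ({ h with roots := h.roots ++ [] } : FibHeap n K).WF := by
    simpa using hw
  obtain ⟨h1, h2, h3, h4⟩ := WF.consolidate h0 List.Pairwise.nil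
  have h5 : (h.consolidate h.roots []).roots.length ≤ maxRank n + 1 := by
    set g := h.consolidate h.roots []
    have h6 : (g.roots.map fun x => (g.children x).length).Nodup :=
      List.pairwise_map.2 h2
    have h7 := List.toFinset_card_of_nodup h6
    rw [List.length_map] at h7
    rw [← h7, ← Finset.card_range (maxRank n + 1)]
    refine Finset.card_le_card fun k hk => ?_
    rw [List.mem_toFinset, List.mem_map] at hk
    obtain ⟨x, _, rfl⟩ := hk
    have := h1.length_children_le x
    simp
    omega
  refine ⟨⟨h1.mem_children, h1.nodup_children, h1.nodup_roots, h1.parent_of_mem_roots,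
      h1.acyclic, h1.ranked⟩, ?_⟩
  have h6 : h.findMin.1.marked = (h.consolidate h.roots []).marked := rfl
  simp only [charge, h6]
  simp only [FibHeap.findMin]
  rw [h3, List.length_nil]
  omega

end FibHeap

end ParametricPath

/-! ### Graph search and tree climbing -/

namespace ParametricPath

section Visit

variable {n : ℕ} (children : Fin n → List (Fin n))

/-- Every entry of the list of children of a newly visited vertex is paid for twice, when it is
pushed and when it is popped. -/
theorem visit_time (stack visited : List (Fin n)) (time : ℕ) :
    (visit children stack visited time).2 + 2 * (visited.map fun x => (children x).length).sum =
      time + 1 + stack.length +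
        2 * ((visit children stack visited time).1.map fun x => (children x).length).sum := by
  induction stack, visited, time using visit.induct children with
  | case1 => simp [visit]
  | case2 x stack visited time hx ih =>
    rw [visit, if_pos hx, ih]
    simp only [List.length_cons]
    omega
  | case3 x stack visited time hx ih =>
    rw [visit, if_neg hx]
    simp only [List.length_cons, List.length_append, List.map_cons, List.sum_cons] at ih ⊢
    omega

theorem nodup_visit (stack : List (Fin n)) {visited : List (Fin n)} (time : ℕ)
    (h : visited.Nodup) : (visit children stack visited time).1.Nodup := by
  induction stack, visited, time using visit.induct children with
  | case1 => simpa [visit] using h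
  | case2 x stack visited time hx ih =>
    rw [visit, if_pos hx]
    exact ih h
  | case3 x stack visited time hx ih =>
    rw [visit, if_neg hx]
    exact ih (List.nodup_cons.2 ⟨hx, h⟩)

theorem mem_visit (stack visited : List (Fin n)) (time : ℕ) {x : Fin n}
    (h : x ∈ visited ∨ x ∈ stack) : x ∈ (visit children stack visited time).1 := by
  induction stack, visited, time using visit.induct children with
  | case1 => simpa [visit] using h
  | case2 y stack visited time hy ih =>
    rw [visit, if_pos hy]
    refine ih ?_
    simp only [List.mem_cons] at h
    rcases h with h | rfl | h <;> tauto
  | case3 y stack visited time hy ih =>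
    rw [visit, if_neg hy]
    refine ih ?_
    simp only [List.mem_cons, List.mem_append] at h ⊢
    tauto

theorem mem_visit_of_mem_children (stack visited : List (Fin n)) (time : ℕ)
    (h : ∀ x ∈ visited, ∀ y ∈ children x, y ∈ visited ∨ y ∈ stack) :
    ∀ x ∈ (visit children stack visited time).1, ∀ y ∈ children x,
      y ∈ (visit children stack visited time).1 := by
  induction stack, visited, time using visit.induct children with
  | case1 => simpa [visit] using h
  | case2 z stack visited time hz ih =>
    rw [visit, if_pos hz]
    refine ih fun x hx y hy => ?_
    have h1 := h x hx y hy
    simp only [List.mem_cons] at h1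
    rcases h1 with h1 | rfl | h1 <;> tauto
  | case3 z stack visited time hz ih =>
    rw [visit, if_neg hz]
    refine ih fun x hx y hy => ?_
    simp only [List.mem_cons, List.mem_append] at hx ⊢
    rcases hx with rfl | hx
    · tauto
    · have h1 := h x hx y hy
      simp only [List.mem_cons] at h1
      tauto

theorem exists_parent_of_mem_visit (stack visited : List (Fin n)) (time : ℕ) {x : Fin n}
    (h : x ∈ (visit children stack visited time).1) :
    x ∈ visited ∨ x ∈ stack ∨ ∃ p ∈ (visit children stack visited time).1, x ∈ children p := by
  induction stack, visited, time using visit.induct children with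
  | case1 => left; simpa [visit] using h
  | case2 z stack visited time hz ih =>
    rw [visit, if_pos hz] at h ⊢
    have h1 := ih h
    simp only [List.mem_cons]
    tauto
  | case3 z stack visited time hz ih =>
    have hzv := mem_visit children (z :: stack) visited time (x := z) (by simp)
    rw [visit, if_neg hz] at h hzv ⊢
    have h1 := ih h
    simp only [List.mem_cons, List.mem_append] at h1 ⊢
    rcases h1 with (rfl | h1) | (h1 | h1) | h1
    · tauto
    · tauto
    · exact Or.inr (Or.inr ⟨z, hzv, h1⟩)
    · tauto
    · tauto

end Visit

theorem length_climb_le {n : ℕ} (parent : Fin n → Option (Fin n)) (v : Fin n) (fuel : ℕ)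
    (x : Fin n) (acc : List (Fin n)) :
    (climb parent v fuel x acc).length ≤ fuel + acc.length := by
  induction fuel generalizing x acc with
  | zero => simp [climb]
  | succ k ih =>
    rw [climb]
    split_ifs
    · simp only [List.length_cons]; omega
    · split
      · simp only [List.length_cons]; omega
      · refine (ih _ _).trans ?_
        simp only [List.length_cons]
        omega

/-! ### Invariants of the path tree and the cost of key updates -/

namespace State

variable {n : ℕ} {K : Type*}

/-- The invariants that concern the tree of paths. -/
structure TreeInvariant (s : State n K) : Prop where
  mem_children : ∀ z w, w ∈ s.treeChildren z ↔ s.treeParent w = some z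
  nodup_children : ∀ z, (s.treeChildren z).Nodup
  cnt_root : ∀ w, s.treeParent w = none → s.cnt w = 0
  cnt_child : ∀ z w, s.treeParent w = some z → s.cnt w = s.cnt z + 1
  jumps_le : ∀ w, s.jumps w ≤ s.cnt w

/-- The tail of the edge that is stored with `w` allows the path to `w` to be replaced. -/
def BestValid (s : State n K) (w : Fin n) : Prop :=
  ∀ u, s.best w = some u → s.cnt w ≤ s.cnt u

/-- The components of the state that do not change when keys are updated. -/
def frame (s : State n K) :=
  (s.treeParent, s.treeChildren, s.cnt, s.jumps, s.inNbrs, s.outNbrs, s.halted)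

/-- The invariants of the algorithm, for a graph with degrees at most `D`. -/
structure Invariant (s : State n K) (D : ℕ) : Prop where
  heap : s.heap.WF
  tree : s.TreeInvariant
  best : ∀ w, s.BestValid w
  inNbrs_le : ∀ w, (s.inNbrs w).length ≤ D
  outNbrs_le : ∀ w, (s.outNbrs w).length ≤ D

/-- The time spent so far, and the potential of the heap. -/
def total (s : State n K) : ℕ := s.time + s.heap.charge

/-- The number of path changes so far. -/
def totalJumps (s : State n K) : ℕ := ∑ w, s.jumps w

theorem TreeInvariant.congr {s t : State n K} (hs : s.TreeInvariant) (h : t.frame = s.frame) :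
    t.TreeInvariant := by
  simp only [frame, Prod.mk.injEq] at h
  obtain ⟨h1, h2, h3, h4, -⟩ := h
  exact ⟨by rw [h1, h2]; exact hs.1, by rw [h2]; exact hs.2, by rw [h1, h3]; exact hs.3,
    by rw [h1, h3]; exact hs.4, by rw [h3, h4]; exact hs.5⟩

/-- Passing to the tree parent lowers `cnt` by exactly one, down to zero at a root, so no value is
skipped. -/
theorem TreeInvariant.exists_cnt_eq {s : State n K} (hs : s.TreeInvariant) (w : Fin n) {k : ℕ}
    (hk : k ≤ s.cnt w) : ∃ x, s.cnt x = k := by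
  induction hc : s.cnt w generalizing w with
  | zero => exact ⟨w, by omega⟩
  | succ c ih =>
    by_cases hkc : k = c + 1
    · exact ⟨w, by omega⟩
    · match hp : s.treeParent w with
      | none => simp [hs.cnt_root w hp] at hc
      | some z =>
        have h1 := hs.cnt_child z w hp
        exact ih z (by omega) (by omega)

/-- A path has fewer edges than the graph has vertices. -/
theorem TreeInvariant.cnt_lt {s : State n K} (hs : s.TreeInvariant) (w : Fin n) :
    s.cnt w < n := by
  have h1 : Finset.range (s.cnt w + 1) ⊆ Finset.univ.image s.cnt := by
    intro k hk
    obtain ⟨x, hx⟩ := hs.exists_cnt_eq w (Nat.lt_succ_iff.1 (Finset.mem_range.1 hk))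
    exact Finset.mem_image.2 ⟨x, Finset.mem_univ x, hx⟩
  have h2 := (Finset.card_le_card h1).trans Finset.card_image_le
  simpa using h2

theorem TreeInvariant.totalJumps_le {s : State n K} (hs : s.TreeInvariant) :
    s.totalJumps ≤ n * n := by
  have h1 : s.totalJumps ≤ ∑ _w : Fin n, n :=
    Finset.sum_le_sum fun w _ => (hs.jumps_le w).trans (hs.cnt_lt w).le
  simpa using h1

/-- The subtree of `v`, as it is found by the algorithm. -/
def subtree (s : State n K) (v : Fin n) : List (Fin n) := (visit s.treeChildren [v] [] 0).1

theorem mem_subtree_self (s : State n K) (v : Fin n) : v ∈ s.subtree v :=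
  mem_visit _ _ _ _ (by simp)

theorem nodup_subtree (s : State n K) (v : Fin n) : (s.subtree v).Nodup :=
  nodup_visit _ _ _ List.nodup_nil

theorem length_subtree_le (s : State n K) (v : Fin n) : (s.subtree v).length ≤ n := by
  simpa using (s.nodup_subtree v).length_le_card

/-- Apart from `v` itself, a vertex and its tree parent are both in the subtree or both outside, so
a pivot shifts their values of `cnt` together. -/
theorem TreeInvariant.mem_subtree_iff {s : State n K} (hs : s.TreeInvariant) {v w z : Fin n}
    (hw : w ≠ v) (hz : s.treeParent w = some z) : w ∈ s.subtree v ↔ z ∈ s.subtree v := by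
  constructor
  · intro h
    rcases exists_parent_of_mem_visit _ _ _ _ h with h1 | h1 | ⟨p, hp, h1⟩
    · simp at h1
    · simp [hw] at h1
    · rw [hs.mem_children, hz, Option.some_inj] at h1
      exact h1 ▸ hp
  · intro h
    exact mem_visit_of_mem_children s.treeChildren [v] [] 0 (by simp) z h w
      ((hs.mem_children z w).2 hz)

theorem TreeInvariant.mem_subtree_of_root {s : State n K} (hs : s.TreeInvariant) {v w : Fin n}
    (hw : w ≠ v) (hz : s.treeParent w = none) : w ∉ s.subtree v := by
  intro h
  rcases exists_parent_of_mem_visit _ _ _ _ h with h1 | h1 | ⟨p, hp, h1⟩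
  · simp at h1
  · simp [hw] at h1
  · rw [hs.mem_children, hz] at h1
    simp at h1

/-- The search of a subtree takes linear time. -/
theorem TreeInvariant.visit_time_le {s : State n K} (hs : s.TreeInvariant) (v : Fin n) :
    (visit s.treeChildren [v] [] 0).2 ≤ 2 + 2 * (s.subtree v).length := by
  have h1 := visit_time s.treeChildren [v] [] 0
  -- Tree parents are unique and the subtree is closed under children, so its lists of children have
  -- total length at most its size.
  have h2 : ((s.subtree v).flatMap s.treeChildren).Nodup := by
    rw [List.nodup_flatMap]
    refine ⟨fun x _ => hs.nodup_children x, (s.nodup_subtree v).imp fun {a b} hab x hxa hxb => ?_⟩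
    have ha := (hs.mem_children a x).1 hxa
    rw [(hs.mem_children b x).1 hxb, Option.some_inj] at ha
    exact hab ha.symm
  have h3 : (s.subtree v).flatMap s.treeChildren ⊆ s.subtree v := by
    intro x hx
    obtain ⟨p, hp, hxp⟩ := List.mem_flatMap.1 hx
    exact mem_visit_of_mem_children s.treeChildren [v] [] 0 (by simp) p hp x hxp
  have h4 := (List.subperm_of_subset h2 h3).length_le
  rw [List.length_flatMap] at h4
  simp only [List.map_nil, List.sum_nil, List.length_cons, List.length_nil] at h1
  change _ = _ + 2 * ((s.subtree v).map fun x => (s.treeChildren x).length).sum at h1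
  omega

theorem inNbrs_eq_of_frame_eq {s t : State n K} (h : t.frame = s.frame) :
    t.inNbrs = s.inNbrs := by
  simp only [frame, Prod.mk.injEq] at h
  exact h.2.2.2.2.1

theorem outNbrs_eq_of_frame_eq {s t : State n K} (h : t.frame = s.frame) :
    t.outNbrs = s.outNbrs := by
  simp only [frame, Prod.mk.injEq] at h
  exact h.2.2.2.2.2.1

theorem Invariant.withTime {s : State n K} {D : ℕ} (hs : s.Invariant D) {h : FibHeap n K}
    (hh : h.WF) (b : Bool) (lam : WithTop K) (cyc : Option (List (Fin n))) (time : ℕ) :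
    ({ s with heap := h, halted := b, lam := lam, cycle := cyc, time := time }
      : State n K).Invariant D :=
  ⟨hh, ⟨hs.tree.1, hs.tree.2, hs.tree.3, hs.tree.4, hs.tree.5⟩, hs.best, hs.inNbrs_le,
    hs.outNbrs_le⟩

theorem foldl_addEdge_spec (s : State n K) (l : List (Fin n × Fin n)) :
    (∃ o i t, l.foldl addEdge s = { s with outNbrs := o, inNbrs := i, time := t }) ∧
      (l.foldl addEdge s).time = s.time + l.length ∧
      (∀ w, ((l.foldl addEdge s).outNbrs w).length =
        (s.outNbrs w).length + l.countP fun e => e.1 = w) ∧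
      ∀ w, ((l.foldl addEdge s).inNbrs w).length =
        (s.inNbrs w).length + l.countP fun e => e.2 = w := by
  induction l generalizing s with
  | nil => exact ⟨⟨_, _, _, rfl⟩, by simp⟩
  | cons e l ih =>
    obtain ⟨⟨o, i, t, h1⟩, h2, h3, h4⟩ := ih (s.addEdge e)
    rw [List.foldl_cons]
    refine ⟨⟨o, i, t, h1⟩, ?_, fun w => ?_, fun w => ?_⟩
    · rw [h2, List.length_cons]
      simp only [addEdge]
      omega
    · rw [h3, List.countP_cons]
      simp only [addEdge]
      by_cases hw : w = e.1
      · subst hw; simp; omega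
      · simp [hw, Ne.symm hw]
    · rw [h4, List.countP_cons]
      simp only [addEdge]
      by_cases hw : w = e.2
      · subst hw; simp; omega
      · simp [hw, Ne.symm hw]

variable [Field K]

theorem TreeInvariant.changePaths {s : State n K} (hs : s.TreeInvariant) {u v : Fin n}
    (hu : u ∉ s.subtree v) (huv : s.cnt v ≤ s.cnt u) :
    (s.changePaths u v (s.subtree v)).TreeInvariant := by
  set c : Fin n → List (Fin n) := match s.treeParent v with
    | none => s.treeChildren
    | some z => Function.update s.treeChildren z ((s.treeChildren z).erase v) with hc
  have hcu : (s.changePaths u v (s.subtree v)).treeChildren = Function.update c u (v :: c u) := rfl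
  clear_value c
  have hmem : ∀ z w, w ∈ c z ↔ s.treeParent w = some z ∧ w ≠ v := by
    intro z w
    rcases hv : s.treeParent v with _ | y <;> simp only [hv] at hc <;> rw [hc]
    · rw [hs.mem_children]
      refine ⟨fun h => ⟨h, ?_⟩, fun h => h.1⟩
      rintro rfl
      simp [hv] at h
    · by_cases hz : z = y
      · subst hz
        rw [Function.update_self, (hs.nodup_children z).mem_erase_iff, hs.mem_children, and_comm]
      · rw [Function.update_of_ne hz, hs.mem_children]
        refine ⟨fun h => ⟨h, ?_⟩, fun h => h.1⟩
        rintro rfl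
        rw [hv, Option.some_inj] at h
        exact hz h.symm
  have hnod : ∀ z, (c z).Nodup := by
    intro z
    rcases hv : s.treeParent v with _ | y <;> simp only [hv] at hc <;> rw [hc]
    · exact hs.nodup_children z
    · by_cases hz : z = y
      · subst hz
        rw [Function.update_self]
        exact (hs.nodup_children z).erase v
      · rw [Function.update_of_ne hz]
        exact hs.nodup_children z
  have hv := s.mem_subtree_self v
  refine ⟨fun z w => ?_, fun z => ?_, fun w hw => ?_, fun z w hw => ?_, fun w => ?_⟩
  · rw [hcu]
    simp only [State.changePaths]
    by_cases hz : z = u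
    · subst hz
      by_cases hw : w = v
      · subst hw; simp
      · simp [hw, hmem]
    · by_cases hw : w = v
      · subst hw
        simpa [hz, hmem] using fun h => hz h.symm
      · simp [hw, hz, hmem]
  · rw [hcu]
    by_cases hz : z = u
    · subst hz
      rw [Function.update_self]
      exact List.nodup_cons.2 ⟨fun h => ((hmem _ _).1 h).2 rfl, hnod z⟩
    · rw [Function.update_of_ne hz]
      exact hnod z
  · simp only [State.changePaths] at hw ⊢
    have hwv : w ≠ v := by rintro rfl; simp at hw
    rw [Function.update_of_ne hwv] at hw
    rw [if_neg (hs.mem_subtree_of_root hwv hw), hs.cnt_root w hw]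
  · simp only [State.changePaths] at hw ⊢
    by_cases hwv : w = v
    · subst hwv
      rw [Function.update_self, Option.some_inj] at hw
      subst hw
      -- `cnt u` does not change, as `u` is outside the subtree, and the truncated subtraction in
      -- the shift is exact by `huv`.
      rw [if_pos hv, if_neg hu]
      omega
    · rw [Function.update_of_ne hwv] at hw
      have h1 := hs.cnt_child z w hw
      simp only [hs.mem_subtree_iff hwv hw]
      split_ifs <;> omega
  -- The shift `cnt u + 1 - cnt v` is at least one by `huv`, so `cnt` keeps pace with `jumps`.
  · simp only [State.changePaths]
    have h1 := hs.jumps_le w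
    split_ifs <;> omega

theorem totalJumps_changePaths (s : State n K) (u v : Fin n) :
    (s.changePaths u v (s.subtree v)).totalJumps = s.totalJumps + (s.subtree v).length := by
  have h1 : ∀ w, (s.changePaths u v (s.subtree v)).jumps w =
      s.jumps w + if w ∈ (s.subtree v).toFinset then 1 else 0 := by
    intro w
    simp only [changePaths, List.mem_toFinset]
    split_ifs <;> rfl
  simp only [totalJumps, h1]
  rw [Finset.sum_add_distrib, Finset.sum_boole, Finset.filter_mem_eq_inter, Finset.univ_inter,
    List.toFinset_card_of_nodup (s.nodup_subtree v), Nat.cast_id]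

theorem cnt_le_cnt_changePaths (s : State n K) (u v : Fin n) (l : List (Fin n)) (w : Fin n) :
    s.cnt w ≤ (s.changePaths u v l).cnt w := by
  simp only [changePaths]
  split_ifs <;> omega

variable [LinearOrder K]

theorem cnt_le_of_edgeKey_lt {s : State n K} {u v : Fin n} {k : WithTop K}
    (h : s.edgeKey u v < k) : s.cnt v ≤ s.cnt u := by
  by_contra hlt
  rw [edgeKey, if_neg (by omega)] at h
  exact not_top_lt h

/-- A tail is stored only after its edge key was strictly below the current minimum, so this key is
not `⊤`. -/
theorem cnt_le_of_scanIn {s : State n K} {u w : Fin n} (h : (s.scanIn w).2 = some u) :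
    s.cnt w ≤ s.cnt u := by
  have key : ∀ (l : List (Fin n)) (b : WithTop K × Option (Fin n)),
      (∀ x, b.2 = some x → s.cnt w ≤ s.cnt x) → ∀ x,
        (l.foldl (fun b u => if s.edgeKey u w < b.1 then (s.edgeKey u w, some u) else b) b).2
          = some x → s.cnt w ≤ s.cnt x := by
    intro l
    induction l with
    | nil => exact fun b hb => hb
    | cons y l ih =>
      intro b hb
      rw [List.foldl_cons]
      refine ih _ fun x hx => ?_
      split_ifs at hx with hlt
      · obtain rfl : y = x := by simpa using hx
        exact cnt_le_of_edgeKey_lt hlt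
      · exact hb x hx
  exact key _ _ (by simp) u h

theorem rekey_spec {s : State n K} (hs : s.heap.WF) (w : Fin n) :
    (s.rekey w).frame = s.frame ∧ (s.rekey w).heap.WF ∧
      (s.rekey w).total ≤ s.total + (9 + 3 * FibHeap.maxRank n + (s.inNbrs w).length) ∧
      ∀ x, (x = w ∨ s.BestValid x) → (s.rekey w).BestValid x := by
  refine ⟨rfl, ?_, ?_, fun x hx u hu => ?_⟩
  · simp only [rekey]
    split_ifs
    · exact hs
    · exact (hs.increaseKey _ _).1
  · simp only [rekey, total]
    split_ifs
    · omega
    · have := (hs.increaseKey w (s.scanIn w).1).2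
      omega
  · simp only [rekey] at hu ⊢
    by_cases hxw : x = w
    · subst hxw
      rw [Function.update_self] at hu
      exact cnt_le_of_scanIn hu
    · rw [Function.update_of_ne hxw] at hu
      exact (hx.resolve_left hxw) u hu

theorem relax_spec {s : State n K} (hs : s.heap.WF) (w x : Fin n) :
    (relax w s x).frame = s.frame ∧ (relax w s x).heap.WF ∧
      (relax w s x).total ≤ s.total + 9 ∧
      ∀ y, s.BestValid y → (relax w s x).BestValid y := by
  unfold relax
  split_ifs with hlt
  · refine ⟨rfl, (hs.decreaseKey _ _).1, ?_, fun y hy u hu => ?_⟩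
    · have := (hs.decreaseKey x (s.edgeKey w x)).2
      simp only [total]
      omega
    · simp only at hu ⊢
      by_cases hyx : y = x
      · subst hyx
        obtain rfl : w = u := by simpa using hu
        exact cnt_le_of_edgeKey_lt hlt
      · rw [Function.update_of_ne hyx] at hu
        exact hy u hu
  · refine ⟨rfl, hs, ?_, fun y hy => hy⟩
    simp only [total]
    omega

theorem foldl_relax_spec {s : State n K} (hs : s.heap.WF) (w : Fin n) (l : List (Fin n)) :
    (l.foldl (relax w) s).frame = s.frame ∧ (l.foldl (relax w) s).heap.WF ∧
      (l.foldl (relax w) s).total ≤ s.total + 9 * l.length ∧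
      ∀ y, s.BestValid y → (l.foldl (relax w) s).BestValid y := by
  induction l generalizing s with
  | nil => exact ⟨rfl, hs, by simp, fun y hy => hy⟩
  | cons x l ih =>
    obtain ⟨h1, h2, h3, h4⟩ := relax_spec hs w x
    obtain ⟨i1, i2, i3, i4⟩ := ih h2
    rw [List.foldl_cons, List.length_cons]
    exact ⟨i1.trans h1, i2, by omega, fun y hy => i4 y (h4 y hy)⟩

theorem relaxOut_spec {s : State n K} (hs : s.heap.WF) (w : Fin n) :
    (s.relaxOut w).frame = s.frame ∧ (s.relaxOut w).heap.WF ∧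
      (s.relaxOut w).total ≤ s.total + (1 + 9 * (s.outNbrs w).length) ∧
      ∀ y, s.BestValid y → (s.relaxOut w).BestValid y := by
  obtain ⟨h1, h2, h3, h4⟩ := foldl_relax_spec (s := { s with time := s.time + 1 }) hs w
    (s.outNbrs w)
  refine ⟨h1, h2, h3.trans ?_, h4⟩
  simp only [total]
  omega

theorem foldl_rekey_spec {s : State n K} (hs : s.heap.WF) {D : ℕ}
    (hD : ∀ w, (s.inNbrs w).length ≤ D) (l : List (Fin n)) :
    (l.foldl rekey s).frame = s.frame ∧ (l.foldl rekey s).heap.WF ∧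
      (l.foldl rekey s).total ≤ s.total + l.length * (9 + 3 * FibHeap.maxRank n + D) ∧
      ∀ x, (x ∈ l ∨ s.BestValid x) → (l.foldl rekey s).BestValid x := by
  induction l generalizing s with
  | nil => exact ⟨rfl, hs, by simp, fun y hy => by simpa using hy⟩
  | cons w l ih =>
    obtain ⟨h1, h2, h3, h4⟩ := rekey_spec hs w
    obtain ⟨i1, i2, i3, i4⟩ := ih h2 (by rw [inNbrs_eq_of_frame_eq h1]; exact hD)
    rw [List.foldl_cons, List.length_cons]
    refine ⟨i1.trans h1, i2, ?_, fun y hy => i4 y ?_⟩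
    · have := hD w
      rw [Nat.succ_mul]
      omega
    · have := h4 y
      rw [List.mem_cons] at hy
      tauto

theorem foldl_relaxOut_spec {s : State n K} (hs : s.heap.WF) {D : ℕ}
    (hD : ∀ w, (s.outNbrs w).length ≤ D) (l : List (Fin n)) :
    (l.foldl relaxOut s).frame = s.frame ∧ (l.foldl relaxOut s).heap.WF ∧
      (l.foldl relaxOut s).total ≤ s.total + l.length * (1 + 9 * D) ∧
      ∀ x, s.BestValid x → (l.foldl relaxOut s).BestValid x := by
  induction l generalizing s with
  | nil => exact ⟨rfl, hs, by simp, fun y hy => hy⟩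
  | cons w l ih =>
    obtain ⟨h1, h2, h3, h4⟩ := relaxOut_spec hs w
    obtain ⟨i1, i2, i3, i4⟩ := ih h2 (by rw [outNbrs_eq_of_frame_eq h1]; exact hD)
    rw [List.foldl_cons, List.length_cons]
    refine ⟨i1.trans h1, i2, ?_, fun y hy => i4 y (h4 y hy)⟩
    have := hD w
    rw [Nat.succ_mul]
    omega

/-! ### Amortized analysis of a round -/

/-- The amortized time for a change of one path. -/
def jumpCost (n D : ℕ) : ℕ := 6 * FibHeap.maxRank n + 22 + 10 * D

/-- The amortized time for the last round. -/
def haltCost (n : ℕ) : ℕ := 3 * FibHeap.maxRank n + 3 * n + 8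

/-- A round that changes the path to `v`. -/
theorem Invariant.pivot {s : State n K} {D : ℕ} (hs : s.Invariant D) {u v : Fin n}
    (hu : u ∉ s.subtree v) (hb : s.best v = some u) :
    let t := (s.subtree v).foldl relaxOut
      ((s.subtree v).foldl rekey (s.changePaths u v (s.subtree v)))
    t.Invariant D ∧ t.halted = s.halted ∧ t.totalJumps = s.totalJumps + (s.subtree v).length ∧
      t.total ≤ s.total + 1 +
        (s.subtree v).length * (11 + 3 * FibHeap.maxRank n + 10 * D) := by
  intro t
  set s1 := s.changePaths u v (s.subtree v) with hs1
  have ht1 : s1.TreeInvariant := hs.tree.changePaths hu (hs.best v u hb)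
  -- Outside the subtree `cnt w` is unchanged while the tail's `cnt` can only grow; inside it,
  -- `rekey` will replace the stored edge.
  have hb1 : ∀ w, w ∈ s.subtree v ∨ s1.BestValid w := by
    intro w
    by_cases hw : w ∈ s.subtree v
    · exact Or.inl hw
    · refine Or.inr fun x hx => ?_
      have h1 : s1.cnt w = s.cnt w := by simp [hs1, changePaths, hw]
      rw [h1]
      exact (hs.best w x hx).trans (cnt_le_cnt_changePaths _ _ _ _ _)
  obtain ⟨a1, a2, a3, a4⟩ := foldl_rekey_spec (s := s1) hs.heap (D := D) hs.inNbrs_le (s.subtree v)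
  set s2 := (s.subtree v).foldl rekey s1
  obtain ⟨b1, b2, b3, b4⟩ := foldl_relaxOut_spec (s := s2) a2 (D := D)
    (by rw [outNbrs_eq_of_frame_eq a1]; exact hs.outNbrs_le) (s.subtree v)
  have hf : t.frame = s1.frame := b1.trans a1
  refine ⟨⟨b2, ht1.congr hf, fun w => b4 w (a4 w (hb1 w)), ?_, ?_⟩, ?_, ?_, ?_⟩
  · rw [inNbrs_eq_of_frame_eq hf]; exact hs.inNbrs_le
  · rw [outNbrs_eq_of_frame_eq hf]; exact hs.outNbrs_le
  · simp only [frame, Prod.mk.injEq] at hf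
    exact hf.2.2.2.2.2.2
  · rw [← totalJumps_changePaths s u v, ← hs1]
    simp only [frame, Prod.mk.injEq] at hf
    simp only [totalJumps, hf.2.2.2.1]
  · have h1 : s1.total = s.total + 1 + (s.subtree v).length := by
      simp only [total, hs1, changePaths]
      omega
    have h2 : (s.subtree v).length * (11 + 3 * FibHeap.maxRank n + 10 * D) =
      (s.subtree v).length + (s.subtree v).length * (9 + 3 * FibHeap.maxRank n + D) +
        (s.subtree v).length * (1 + 9 * D) := by ring
    rw [h2]
    change State.total t ≤ _ at b3
    omega

/-- The amortized analysis of a round. -/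
theorem Invariant.step {s : State n K} {D : ℕ} (hs : s.Invariant D) (hh : s.halted = false) :
    s.step.Invariant D ∧
      s.step.total + (if s.step.halted then 0 else haltCost n) + jumpCost n D * s.totalJumps
        ≤ s.total + haltCost n + jumpCost n D * s.step.totalJumps := by
  obtain ⟨f1, f2⟩ := hs.heap.findMin
  have ht : s.time + s.heap.findMin.1.charge ≤ s.total + 3 * FibHeap.maxRank n + 5 := by
    simp only [total]
    omega
  rcases hv : s.heap.findMin.2 with _ | v
  · have e : s.step = { s with
        heap := s.heap.findMin.1, halted := true, time := s.time + 1 } := by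
      simp [State.step, hh, hv]
    rw [e]
    refine ⟨hs.withTime f1 true s.lam s.cycle _, ?_⟩
    simp only [totalJumps, total, haltCost, if_true] at ht ⊢
    omega
  rcases hu : s.best v with _ | u
  · have e : s.step = { s with
        heap := s.heap.findMin.1, halted := true, lam := ⊤, time := s.time + 1 } := by
      simp [State.step, hh, hv, hu]
    rw [e]
    refine ⟨hs.withTime f1 true ⊤ s.cycle _, ?_⟩
    simp only [totalJumps, total, haltCost, if_true] at ht ⊢
    omega
  have hv1 := hs.tree.visit_time_le v
  have hv2 := s.length_subtree_le v
  by_cases hmem : u ∈ s.subtree v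
  · have e : s.step = { s with
        heap := s.heap.findMin.1
        lam := s.heap.findMin.1.key v
        halted := true
        cycle := some (climb s.treeParent v n u [])
        time := s.time + 1 + (visit s.treeChildren [v] [] 0).2
          + (climb s.treeParent v n u []).length } := by
      rw [subtree] at hmem
      simp [State.step, hh, hv, hu, hmem]
    rw [e]
    refine ⟨hs.withTime f1 true _ _ _, ?_⟩
    -- This is the dearest way to halt: the term `3 * n` in `haltCost` covers the search of the
    -- subtree, at most `2 * n + 2`, and the output of the cycle, at most `n`.
    have hc := length_climb_le s.treeParent v n u []
    rw [List.length_nil] at hc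
    simp only [totalJumps, total, haltCost, if_true] at ht ⊢
    omega
  · set t : State n K := { s with
      heap := s.heap.findMin.1
      lam := s.heap.findMin.1.key v
      time := s.time + 1 + (visit s.treeChildren [v] [] 0).2 } with ht'
    have e : s.step = (t.subtree v).foldl relaxOut
        ((t.subtree v).foldl rekey (t.changePaths u v (t.subtree v))) := by
      have hmem' := hmem
      rw [subtree] at hmem'
      simp [State.step, hh, hv, hu, hmem', ht', subtree]
    have hti : t.Invariant D := hs.withTime f1 s.halted _ s.cycle _
    obtain ⟨p1, p2, p3, p4⟩ := hti.pivot (u := u) (v := v) hmem hu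
    rw [← e] at p1 p2 p3 p4
    refine ⟨p1, ?_⟩
    have e1 : t.halted = false := hh
    have e2 : t.totalJumps = s.totalJumps := rfl
    have e3 : t.total = s.time + 1 + (visit s.treeChildren [v] [] 0).2
      + s.heap.findMin.1.charge := rfl
    have e4 : t.subtree v = s.subtree v := rfl
    have hpos : 1 ≤ (s.subtree v).length := List.length_pos_of_mem (s.mem_subtree_self v)
    rw [e1] at p2
    rw [e2, e4] at p3
    rw [e3, e4] at p4
    rw [p2, p3]
    simp only [Bool.false_eq_true, if_false]
    -- The summand `3 * maxRank n + 9` is the cost of the round that does not depend on the size of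
    -- the subtree. One path change suffices to pay for it, and `hpos` provides one. The factor 2
    -- covers the search of the subtree.
    have hexp : jumpCost n D * (s.totalJumps + (s.subtree v).length) =
        jumpCost n D * s.totalJumps +
          (s.subtree v).length * (11 + 3 * FibHeap.maxRank n + 10 * D) +
          2 * (s.subtree v).length +
          (s.subtree v).length * (3 * FibHeap.maxRank n + 9) := by
      simp only [jumpCost]; ring
    have hle := Nat.mul_le_mul_right (3 * FibHeap.maxRank n + 9) hpos
    rw [hexp]
    omega

/-- The amortized analysis of the algorithm. -/
theorem Invariant.iterate {s : State n K} {D : ℕ} (hs : s.Invariant D) (hh : s.halted = false)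
    (k : ℕ) : (State.step^[k] s).Invariant D ∧
      (State.step^[k] s).total + (if (State.step^[k] s).halted then 0 else haltCost n)
          + jumpCost n D * s.totalJumps
        ≤ s.total + haltCost n + jumpCost n D * (State.step^[k] s).totalJumps := by
  induction k with
  | zero =>
    refine ⟨hs, ?_⟩
    simp [hh]
  | succ k ih =>
    rw [Function.iterate_succ_apply']
    obtain ⟨i1, i2⟩ := ih
    set t := State.step^[k] s
    cases ht : t.halted with
    | true =>
      have h1 : t.step = t := by simp [State.step, ht]
      rw [h1]
      exact ⟨i1, i2⟩
    | false =>
      obtain ⟨j1, j2⟩ := i1.step ht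
      refine ⟨j1, ?_⟩
      simp only [ht, Bool.false_eq_true, if_false] at i2
      omega

/-! ### Initialization and the bound for a whole run -/

theorem foldl_insertVertex_spec {s : State n K} (hs : s.heap.WF)
    (hp : ∀ w, s.heap.parent w = none) (hb : ∀ w, s.BestValid w) {l : List (Fin n)}
    (hl : l.Nodup) (hr : ∀ w ∈ l, w ∉ s.heap.roots) :
    (l.foldl insertVertex s).heap.WF ∧ (∀ w, (l.foldl insertVertex s).BestValid w) ∧
      (l.foldl insertVertex s).frame = s.frame ∧
      (l.foldl insertVertex s).total =
        s.total + (l.map fun w => 4 + (s.inNbrs w).length).sum := by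
  induction l generalizing s with
  | nil => exact ⟨hs, hb, rfl, rfl⟩
  | cons v l ih =>
    rw [List.nodup_cons] at hl
    have hb' : ∀ w, (s.insertVertex v).BestValid w := by
      intro w u hu
      simp only [insertVertex] at hu ⊢
      by_cases hwv : w = v
      · subst hwv
        rw [Function.update_self] at hu
        exact cnt_le_of_scanIn hu
      · rw [Function.update_of_ne hwv] at hu
        exact hb w u hu
    have hr' : ∀ w ∈ l, w ∉ (s.insertVertex v).heap.roots := by
      intro w hw
      simp only [insertVertex, FibHeap.insert, List.mem_cons, not_or]
      exact ⟨fun h => hl.1 (h ▸ hw), hr w (List.mem_cons_of_mem _ hw)⟩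
    obtain ⟨h1, h2, h3, h4⟩ := ih (s := s.insertVertex v)
      (hs.insert _ (hp v) (hr v (by simp))) hp hb' hl.2 hr'
    rw [List.foldl_cons]
    refine ⟨h1, h2, h3, ?_⟩
    have h5 : (s.insertVertex v).total = s.total + (4 + (s.inNbrs v).length) := by
      simp only [insertVertex, total, FibHeap.charge_insert]
      omega
    have h6 : (s.insertVertex v).inNbrs = s.inNbrs := rfl
    rw [h4, h5, h6, List.map_cons, List.sum_cons]
    omega

theorem sum_countP_eq_length {α : Type*} (f : α → Fin n) (l : List α) :
    ∑ w, (l.countP fun e => f e = w) = l.length := by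
  induction l with
  | nil => simp
  | cons e l ih =>
    simp only [List.countP_cons, List.length_cons, Finset.sum_add_distrib, ih]
    simp

theorem init_spec (edges : List (Fin n × Fin n)) (cost : Fin n × Fin n → K) {D : ℕ}
    (hout : ∀ w, (edges.countP fun e => e.1 = w) ≤ D)
    (hin : ∀ w, (edges.countP fun e => e.2 = w) ≤ D) :
    (init edges cost).Invariant D ∧ (init edges cost).halted = false ∧
      (init edges cost).total = 5 * n + 2 * edges.length ∧
      (init edges cost).totalJumps = 0 := by
  obtain ⟨⟨o, i, t, h1⟩, h2, h3, h4⟩ := foldl_addEdge_spec (blank n cost) edges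
  unfold init
  set s := edges.foldl addEdge (blank n cost)
  have e1 : s.heap = FibHeap.empty n K := by rw [h1]; rfl
  have e2 : s.BestValid = fun _ => True := by
    funext w
    rw [h1]
    simp [BestValid, blank]
  have e3 : s.TreeInvariant := by
    rw [h1]
    exact ⟨by simp [blank], by simp [blank], by simp [blank], by simp [blank], by simp [blank]⟩
  obtain ⟨i1, i2, i3, i4⟩ := foldl_insertVertex_spec (s := s) (l := List.finRange n)
    (by rw [e1]; exact FibHeap.wf_empty) (by simp [e1, FibHeap.empty]) (by simp [e2])
    (List.nodup_finRange n) (by simp [e1, FibHeap.empty])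
  refine ⟨⟨i1, e3.congr i3, i2, ?_, ?_⟩, ?_, ?_, ?_⟩
  · rw [inNbrs_eq_of_frame_eq i3]
    intro w
    rw [h4]
    simpa [blank] using hin w
  · rw [outNbrs_eq_of_frame_eq i3]
    intro w
    rw [h3]
    simpa [blank] using hout w
  · have h5 : s.halted = false := by rw [h1]; rfl
    rw [← h5]
    simp only [frame, Prod.mk.injEq] at i3
    exact i3.2.2.2.2.2.2
  · have h5 : (FibHeap.empty n K).charge = 0 := by
      simp [FibHeap.charge, FibHeap.empty, FibHeap.marked]
    have h6 : (blank n cost).inNbrs = fun _ => [] := rfl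
    have h7 : (blank n cost).time = n := rfl
    have h8 : s.total = n + edges.length := by
      rw [total, e1, h5, h2, h7, add_zero]
    rw [i4, h8]
    simp only [h4, h6, List.length_nil, zero_add]
    rw [← Fin.sum_univ_def, Finset.sum_add_distrib, sum_countP_eq_length]
    simp
    omega
  · have h5 : s.jumps = fun _ => 0 := by rw [h1]; rfl
    simp only [frame, Prod.mk.injEq] at i3
    simp only [totalJumps, i3.2.2.2.1, h5]
    simp

end State

/-- The time that is spent independently of the number of path changes. -/
def baseCost (n m : ℕ) : ℕ := 5 * n + 2 * m + State.haltCost n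

/-- The amortized analysis of a run of the algorithm. -/
theorem runningTime_le {n : ℕ} (edges : List (Fin n × Fin n)) (cost : Fin n × Fin n → ℝ) {D : ℕ}
    (hout : ∀ w, (edges.countP fun e => e.1 = w) ≤ D)
    (hin : ∀ w, (edges.countP fun e => e.2 = w) ≤ D) :
    runningTime edges cost ≤
      baseCost n edges.length + State.jumpCost n D * pathChanges edges cost := by
  refine iSup_le fun k => ?_
  obtain ⟨h1, h2, h3, h4⟩ := State.init_spec edges cost hout hin
  have h5 := (h1.iterate h2 k).2
  have h6 : (((State.step^[k] (State.init edges cost)).totalJumps : ℕ) : ℕ∞)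
      ≤ pathChanges edges cost :=
    le_iSup (fun k => ((∑ w, (State.step^[k] (State.init edges cost)).jumps w : ℕ) : ℕ∞)) k
  refine le_trans ?_ (add_le_add_right (mul_le_mul_right h6 _) _)
  rw [h3, h4] at h5
  simp only [State.total, FibHeap.charge] at h5
  norm_cast
  unfold baseCost
  omega

/-- Since `jumps w ≤ cnt w < n`, this holds for every graph; the trivial degree bound `edges.length`
is used only to have the invariant available. -/
theorem pathChanges_le {n : ℕ} (edges : List (Fin n × Fin n)) (cost : Fin n × Fin n → ℝ) :
    pathChanges edges cost ≤ (n * n : ℕ) := by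
  refine iSup_le fun k => ?_
  obtain ⟨h1, h2, -⟩ := State.init_spec edges cost (D := edges.length)
    (fun _ => List.countP_le_length) (fun _ => List.countP_le_length)
  exact_mod_cast (h1.iterate h2 k).1.tree.totalJumps_le

end ParametricPath

/-! ### Exponential moments of the degrees of a random digraph -/

namespace ParametricPath

/-- The quotient of the two binomial coefficients is the product of the factors (m - i) / (N - i),
each at most m / N. -/
theorem choose_mul_pow_le {N m : ℕ} (hm : m ≤ N) (s : ℕ) :
    m.choose s * N ^ s ≤ N.choose s * m ^ s := by
  have h1 : m.descFactorial s * N ^ s ≤ N.descFactorial s * m ^ s := by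
    induction s with
    | zero => simp
    | succ s ih =>
      rw [Nat.descFactorial_succ, Nat.descFactorial_succ, pow_succ, pow_succ]
      have h2 : (m - s) * N ≤ (N - s) * m := by
        rw [Nat.sub_mul, Nat.sub_mul, mul_comm m N]
        exact Nat.sub_le_sub_left (Nat.mul_le_mul_left s hm) _
      calc (m - s) * m.descFactorial s * (N ^ s * N)
          = ((m - s) * N) * (m.descFactorial s * N ^ s) := by ring
        _ ≤ ((N - s) * m) * (N.descFactorial s * m ^ s) := Nat.mul_le_mul h2 ih
        _ = _ := by ring
  rw [Nat.descFactorial_eq_factorial_mul_choose, Nat.descFactorial_eq_factorial_mul_choose,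
    mul_assoc, mul_assoc] at h1
  exact Nat.le_of_mul_le_mul_left h1 s.factorial_pos

/-- A random `m`-subset of an `N`-set contains a given `s`-set with probability at most
`(m / N) ^ s`. -/
theorem card_filter_superset_mul_pow_le {α : Type*} [DecidableEq α] {U S : Finset α} (hS : S ⊆ U)
    {m : ℕ} (hm : m ≤ U.card) :
    ((U.powersetCard m).filter (S ⊆ ·)).card * U.card ^ S.card
      ≤ U.card.choose m * m ^ S.card := by
  by_cases hSm : S.card ≤ m
  · rw [Finset.card_filter_powersetCard_subset S U m hS hSm]
    refine Nat.le_of_mul_le_mul_left ?_ (Nat.choose_pos (Finset.card_le_card hS))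
    calc _ = U.card.choose S.card * (U.card - S.card).choose (m - S.card) * U.card ^ S.card := by
          ring
      _ = U.card.choose m * (m.choose S.card * U.card ^ S.card) := by
          rw [← Nat.choose_mul hSm, mul_assoc]
      _ ≤ U.card.choose m * (U.card.choose S.card * m ^ S.card) :=
          Nat.mul_le_mul_left _ (choose_mul_pow_le hm _)
      _ = _ := by ring
  · rw [Finset.card_eq_zero.2, zero_mul]
    · exact Nat.zero_le _
    · refine Finset.filter_eq_empty_iff.2 fun E hE hSE => hSm ?_
      rw [← (Finset.mem_powersetCard.1 hE).2]
      exact Finset.card_le_card hSE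

/-- The exponential moment of the number of elements of `A` in a random `m`-subset of `U`. -/
theorem sum_two_pow_card_filter_le {α : Type*} [DecidableEq α] {U : Finset α} {m : ℕ}
    (hm : m ≤ U.card) (hU : 0 < U.card) (p : α → Prop) [DecidablePred p] :
    ∑ E ∈ U.powersetCard m, (2 : ℝ) ^ (E.filter p).card
      ≤ U.card.choose m * (1 + (m : ℝ) / U.card) ^ (U.filter p).card := by
  -- The power of two counts the subsets `S` of the part of `U` with property `p` that lie in `E`.
  -- After exchanging the sums, each `S` contributes an inclusion probability, and the binomial
  -- theorem sums the bounds.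
  have h1 : ∀ E ∈ U.powersetCard m, (2 : ℝ) ^ (E.filter p).card
      = ∑ S ∈ (U.filter p).powerset, if S ⊆ E then (1 : ℝ) else 0 := by
    intro E hE
    rw [Finset.sum_boole]
    have h2 : (U.filter p).powerset.filter (· ⊆ E) = (E.filter p).powerset := by
      ext S
      simp only [Finset.mem_filter, Finset.mem_powerset, Finset.subset_iff]
      have := (Finset.mem_powersetCard.1 hE).1
      exact ⟨fun h x hx => ⟨h.2 hx, (h.1 hx).2⟩,
        fun h => ⟨fun x hx => ⟨this (h hx).1, (h hx).2⟩, fun x hx => (h hx).1⟩⟩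
    rw [h2, Finset.card_powerset]
    push_cast
    rfl
  have hU' : (0 : ℝ) < U.card := by exact_mod_cast hU
  calc _ = ∑ S ∈ (U.filter p).powerset, (((U.powersetCard m).filter (S ⊆ ·)).card : ℝ) := by
        rw [Finset.sum_congr rfl h1, Finset.sum_comm]
        exact Finset.sum_congr rfl fun S _ => Finset.sum_boole _ _
    _ ≤ ∑ S ∈ (U.filter p).powerset, (U.card.choose m : ℝ) * ((m : ℝ) / U.card) ^ S.card := by
        refine Finset.sum_le_sum fun S hS => ?_
        have hSU : S ⊆ U := (Finset.mem_powerset.1 hS).trans (Finset.filter_subset _ _)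
        rw [div_pow, ← mul_div_assoc, le_div_iff₀ (by positivity)]
        exact_mod_cast card_filter_superset_mul_pow_le hSU hm
    _ = _ := by
        rw [← Finset.mul_sum]
        congr 1
        have := Finset.sum_pow_mul_eq_add_pow ((m : ℝ) / U.card) 1 (U.filter p)
        simp only [one_pow, mul_one] at this
        rw [this, add_comm]

namespace IsRandomDigraph

variable {Ω : Type*} [MeasurableSpace Ω] {μ : Measure Ω} {n m : ℕ}
  {edges : Ω → List (Fin n × Fin n)}

/-- There are only countably many lists, so measurable fibres make `edges` measurable even for the
discrete σ-algebra. -/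
theorem measurable_comp (h : IsRandomDigraph μ n m edges) {β : Type*} [MeasurableSpace β]
    (f : List (Fin n × Fin n) → β) : Measurable fun ω => f (edges ω) := by
  let _ : MeasurableSpace (List (Fin n × Fin n)) := ⊤
  have h1 : Measurable edges := measurable_to_countable' h.measurableSet
  exact measurable_from_top.comp h1

theorem toFinset_mem (h : IsRandomDigraph μ n m edges) (ω : Ω) :
    (edges ω).toFinset ∈ ((Finset.univ : Finset (Fin n)).offDiag).powersetCard m := by
  refine Finset.mem_powersetCard.2 ⟨fun e he => ?_, ?_⟩
  · rw [List.mem_toFinset] at he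
    simpa using h.loopless ω e he
  · rw [List.toFinset_card_of_nodup (h.nodup ω), h.length]

theorem card_offDiag (n : ℕ) :
    (Finset.univ : Finset (Fin n)).offDiag.card = n * (n - 1) := by
  rw [Finset.offDiag_card, Finset.card_univ, Fintype.card_fin, Nat.mul_sub, mul_one]

theorem le_mul [IsProbabilityMeasure μ] (h : IsRandomDigraph μ n m edges) : m ≤ n * (n - 1) := by
  obtain ⟨ω⟩ := nonempty_of_isProbabilityMeasure μ
  have h1 := Finset.mem_powersetCard.1 (h.toFinset_mem ω)
  rw [← card_offDiag, ← h1.2]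
  exact Finset.card_le_card h1.1

theorem lintegral_toFinset (h : IsRandomDigraph μ n m edges)
    (f : Finset (Fin n × Fin n) → ℝ≥0∞) :
    ∫⁻ ω, f (edges ω).toFinset ∂μ =
      ((n * (n - 1)).choose m : ℝ≥0∞)⁻¹ *
        ∑ E ∈ ((Finset.univ : Finset (Fin n)).offDiag).powersetCard m, f E := by
  let _ : MeasurableSpace (Finset (Fin n × Fin n)) := ⊤
  have h1 : Measurable fun ω => (edges ω).toFinset := h.measurable_comp List.toFinset
  rw [← lintegral_map (f := f) measurable_from_top h1, lintegral_fintype, Finset.mul_sum]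
  symm
  refine (Finset.sum_congr rfl fun E hE => ?_).trans
    (Finset.sum_subset (Finset.subset_univ _) fun E _ hE => ?_)
  · rw [Measure.map_apply h1 trivial, mul_comm]
    obtain ⟨h2, h3⟩ := Finset.mem_powersetCard.1 hE
    congr 1
    exact (h.uniform E h3 fun e he => by simpa using h2 he).symm
  -- Sets that are not `m`-sets of loopless pairs are never attained.
  · rw [Measure.map_apply h1 trivial]
    have h2 : (fun ω => (edges ω).toFinset) ⁻¹' {E} = ∅ := by
      refine Set.eq_empty_of_forall_notMem fun ω hω => hE ?_
      rw [← Set.mem_singleton_iff.1 hω]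
      exact h.toFinset_mem ω
    rw [h2, measure_empty, mul_zero]

/-- The exponential moment of the number of edges with the property `p`, when at most `n - 1` of the
possible edges have this property. -/
theorem lintegral_two_pow_countP_le [IsProbabilityMeasure μ] (h : IsRandomDigraph μ n m edges)
    (hn : 2 ≤ n) (p : Fin n × Fin n → Prop) [DecidablePred p]
    (hp : ((Finset.univ : Finset (Fin n)).offDiag.filter p).card ≤ n - 1) :
    ∫⁻ ω, (2 : ℝ≥0∞) ^ ((edges ω).countP fun e => p e) ∂μ
      ≤ ENNReal.ofReal (Real.exp (m / n)) := by
  have h1 : ∀ ω, ((edges ω).countP fun e => p e) = ((edges ω).toFinset.filter p).card := by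
    intro ω
    rw [List.countP_eq_length_filter, ← List.toFinset_card_of_nodup ((h.nodup ω).filter _),
      List.toFinset_filter]
    simp only [decide_eq_true_eq]
  simp only [h1]
  rw [h.lintegral_toFinset fun E => (2 : ℝ≥0∞) ^ (E.filter p).card]
  have hU := card_offDiag n
  have hpos : 0 < n * (n - 1) := Nat.mul_pos (by omega) (by omega)
  have h2 := sum_two_pow_card_filter_le (U := (Finset.univ : Finset (Fin n)).offDiag) (m := m)
    (by rw [hU]; exact h.le_mul) (by rw [hU]; exact hpos) p
  rw [hU] at h2
  have hn1 : (0 : ℝ) < (n - 1 : ℕ) := by exact_mod_cast (by omega : 0 < n - 1)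
  have hn0 : (0 : ℝ) < n := by exact_mod_cast (by omega : 0 < n)
  have h3 : (1 + (m : ℝ) / (n * (n - 1) : ℕ))
      ^ ((Finset.univ : Finset (Fin n)).offDiag.filter p).card ≤ Real.exp (m / n) := by
    have h4 : (1 : ℝ) ≤ 1 + (m : ℝ) / (n * (n - 1) : ℕ) := by
      have : (0 : ℝ) ≤ (m : ℝ) / (n * (n - 1) : ℕ) := by positivity
      linarith
    refine (pow_le_pow_right₀ h4 hp).trans ?_
    have h5 : 1 + (m : ℝ) / (n * (n - 1) : ℕ) ≤ Real.exp ((m : ℝ) / (n * (n - 1) : ℕ)) := by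
      rw [add_comm]
      exact Real.add_one_le_exp _
    refine (pow_le_pow_left₀ (by linarith) h5 _).trans ?_
    -- The exponent is (n - 1) · m / (n (n - 1)) = m / n.
    rw [← Real.exp_nat_mul]
    refine Real.exp_le_exp.2 (le_of_eq ?_)
    push_cast
    field_simp
  have hc : (0 : ℝ) < (n * (n - 1)).choose m := by exact_mod_cast Nat.choose_pos h.le_mul
  rw [mul_comm, ← div_eq_mul_inv]
  refine ENNReal.div_le_of_le_mul ?_
  have h6 := ENNReal.ofReal_le_ofReal (h2.trans (mul_le_mul_of_nonneg_left h3 hc.le))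
  rw [ENNReal.ofReal_sum_of_nonneg (fun _ _ => by positivity), ENNReal.ofReal_mul hc.le,
    ENNReal.ofReal_natCast, mul_comm] at h6
  refine le_trans (le_of_eq (Finset.sum_congr rfl fun E _ => ?_)) h6
  rw [ENNReal.ofReal_pow (by norm_num), ENNReal.ofReal_ofNat]

theorem card_filter_fst_le (w : Fin n) :
    ((Finset.univ : Finset (Fin n)).offDiag.filter fun e => e.1 = w).card ≤ n - 1 := by
  have h1 : ((Finset.univ : Finset (Fin n)).offDiag.filter fun e => e.1 = w)
      ⊆ (Finset.univ.erase w).image fun x => (w, x) := by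
    intro e he
    simp only [Finset.mem_filter, Finset.mem_offDiag, Finset.mem_univ, true_and] at he
    refine Finset.mem_image.2 ⟨e.2, ?_, ?_⟩
    · simpa using fun h => he.1 (he.2.trans h.symm)
    · rw [← he.2]
  refine (Finset.card_le_card h1).trans (Finset.card_image_le.trans ?_)
  simp

theorem card_filter_snd_le (w : Fin n) :
    ((Finset.univ : Finset (Fin n)).offDiag.filter fun e => e.2 = w).card ≤ n - 1 := by
  have h1 : ((Finset.univ : Finset (Fin n)).offDiag.filter fun e => e.2 = w)
      ⊆ (Finset.univ.erase w).image fun x => (x, w) := by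
    intro e he
    simp only [Finset.mem_filter, Finset.mem_offDiag, Finset.mem_univ, true_and] at he
    refine Finset.mem_image.2 ⟨e.1, ?_, ?_⟩
    · simpa using fun h => he.1 (h.trans he.2.symm)
    · rw [← he.2]
  refine (Finset.card_le_card h1).trans (Finset.card_image_le.trans ?_)
  simp

end IsRandomDigraph

/-- The sum of the exponentials, to base two, of the degrees. -/
def degreeExpSum {n : ℕ} (edges : List (Fin n × Fin n)) : ℕ :=
  ∑ w, (2 ^ (edges.countP fun e => e.1 = w) + 2 ^ (edges.countP fun e => e.2 = w))

theorem IsRandomDigraph.lintegral_degreeExpSum_le {Ω : Type*} [MeasurableSpace Ω] {μ : Measure Ω}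
    [IsProbabilityMeasure μ] {n m : ℕ} {edges : Ω → List (Fin n × Fin n)}
    (h : IsRandomDigraph μ n m edges) (hn : 2 ≤ n) :
    ∫⁻ ω, (degreeExpSum (edges ω) : ℝ≥0∞) ∂μ ≤ 2 * n * ENNReal.ofReal (Real.exp (m / n)) := by
  simp only [degreeExpSum, Nat.cast_sum, Nat.cast_add, Nat.cast_pow, Nat.cast_ofNat]
  rw [lintegral_finsetSum _ fun w _ => h.measurable_comp fun l =>
    (2 : ℝ≥0∞) ^ (l.countP fun e => e.1 = w) + 2 ^ (l.countP fun e => e.2 = w)]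
  have h1 : ∀ w : Fin n, ∫⁻ ω, ((2 : ℝ≥0∞) ^ ((edges ω).countP fun e => e.1 = w)
      + 2 ^ ((edges ω).countP fun e => e.2 = w)) ∂μ
        ≤ 2 * ENNReal.ofReal (Real.exp (m / n)) := by
    intro w
    rw [lintegral_add_left (h.measurable_comp fun l =>
      (2 : ℝ≥0∞) ^ (l.countP fun e => e.1 = w)), two_mul]
    exact add_le_add
      (h.lintegral_two_pow_countP_le hn (fun e => e.1 = w) (card_filter_fst_le w))
      (h.lintegral_two_pow_countP_le hn (fun e => e.2 = w) (card_filter_snd_le w))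
  refine (Finset.sum_le_sum fun w _ => h1 w).trans (le_of_eq ?_)
  rw [Finset.sum_const, Finset.card_univ, Fintype.card_fin, nsmul_eq_mul]
  ring

/-! ### Truncating the degrees and bounding the expectation -/

/-- The running time in terms of the number of path changes and a threshold for the degrees. -/
theorem runningTime_le_of_threshold {n : ℕ} (edges : List (Fin n × Fin n))
    (cost : Fin n × Fin n → ℝ) (hn : 2 ≤ n) (T : ℕ) :
    (runningTime edges cost : ℝ≥0∞) ≤ baseCost n edges.length
      + (State.jumpCost n T : ℝ≥0∞) * pathChanges edges cost
      + (10 * (n * n : ℕ) / 2 ^ T : ℝ≥0∞) * degreeExpSum edges := by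
  set Y := degreeExpSum edges
  set D := Nat.log 2 Y
  have hle : ∀ w, 2 ^ (edges.countP fun e => e.1 = w) + 2 ^ (edges.countP fun e => e.2 = w) ≤ Y :=
    fun w => Finset.single_le_sum (f := fun w => 2 ^ (edges.countP fun e => e.1 = w)
      + 2 ^ (edges.countP fun e => e.2 = w)) (fun _ _ => Nat.zero_le _) (Finset.mem_univ w)
  have hY0 : Y ≠ 0 := by
    have h1 := (Nat.le_add_right _ _).trans (hle ⟨0, by omega⟩)
    exact ((Nat.two_pow_pos _).trans_le h1).ne'
  have h1 := runningTime_le edges cost (D := D)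
    (fun w => Nat.le_log_of_pow_le (by norm_num) ((Nat.le_add_right _ _).trans (hle w)))
    (fun w => Nat.le_log_of_pow_le (by norm_num) ((Nat.le_add_left _ _).trans (hle w)))
  -- From k ≤ 2^k with k = D - T: the excess over the threshold is linear in `Y`, so that its
  -- expectation is controlled by that of `Y`.
  have h2 : (D - T) * 2 ^ T ≤ Y := by
    by_cases hDT : D ≤ T
    · simp [Nat.sub_eq_zero_of_le hDT]
    · calc (D - T) * 2 ^ T ≤ 2 ^ (D - T) * 2 ^ T := Nat.mul_le_mul_right _ Nat.lt_two_pow_self.le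
        _ = 2 ^ D := by rw [← pow_add]; congr 1; omega
        _ ≤ Y := Nat.pow_log_le_self 2 hY0
  have h3 : State.jumpCost n D ≤ State.jumpCost n T + 10 * (D - T) := by
    unfold State.jumpCost
    omega
  have h4 : ((D - T : ℕ) : ℝ≥0∞) ≤ Y / 2 ^ T := by
    rw [ENNReal.le_div_iff_mul_le (by simp) (by simp)]
    exact_mod_cast h2
  -- The worst-case bound is used only against the excess `D - T`. It decouples the path changes
  -- from the degrees.
  have h5 : (pathChanges edges cost : ℝ≥0∞) ≤ (n * n : ℕ) := by
    rw [← ENat.toENNReal_coe, ENat.toENNReal_le]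
    exact pathChanges_le edges cost
  have h6 : (runningTime edges cost : ℝ≥0∞) ≤ baseCost n edges.length
      + (State.jumpCost n D : ℝ≥0∞) * pathChanges edges cost := by
    rw [← ENat.toENNReal_le] at h1
    simpa using h1
  refine h6.trans ?_
  rw [add_assoc]
  gcongr
  calc (State.jumpCost n D : ℝ≥0∞) * pathChanges edges cost
      ≤ (State.jumpCost n T + 10 * (D - T : ℕ) : ℝ≥0∞) * pathChanges edges cost := by
        gcongr
        exact_mod_cast h3
    _ = State.jumpCost n T * pathChanges edges cost
        + 10 * (D - T : ℕ) * pathChanges edges cost := add_mul _ _ _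
    _ ≤ State.jumpCost n T * pathChanges edges cost + 10 * (Y / 2 ^ T) * (n * n : ℕ) := by
        gcongr
    _ = _ := by
        simp only [div_eq_mul_inv]
        ring

/-- The threshold for the degrees. -/
noncomputable def threshold (n m : ℕ) : ℕ := 2 * ⌈(m / n : ℝ)⌉₊ + 3 * (Nat.log 2 n + 1)

/-- The two summands of the threshold come from e ≤ 2² and n ≤ 2^(log₂ n + 1). The cube of n absorbs
the factor n² from the bound on the path changes and the number n of vertices in the degree sum. -/
theorem exp_mul_pow_le_two_pow_threshold {n : ℕ} (m : ℕ) :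
    Real.exp (m / n) * (n : ℝ) ^ 3 ≤ 2 ^ threshold n m := by
  have h1 : Real.exp (m / n) ≤ 2 ^ (2 * ⌈(m / n : ℝ)⌉₊) := by
    calc Real.exp (m / n) ≤ Real.exp (⌈(m / n : ℝ)⌉₊ * 1) := by
          rw [mul_one]
          exact Real.exp_le_exp.2 (Nat.le_ceil _)
      _ = Real.exp 1 ^ ⌈(m / n : ℝ)⌉₊ := Real.exp_nat_mul _ _
      _ ≤ (2 ^ 2) ^ ⌈(m / n : ℝ)⌉₊ := by
          have := Real.exp_one_lt_d9
          gcongr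
          linarith
      _ = _ := by rw [← pow_mul]
  have h2 : (n : ℝ) ≤ 2 ^ (Nat.log 2 n + 1) := by
    exact_mod_cast (Nat.lt_pow_succ_log_self (by norm_num) n).le
  calc Real.exp (m / n) * (n : ℝ) ^ 3
      ≤ 2 ^ (2 * ⌈(m / n : ℝ)⌉₊) * (2 ^ (Nat.log 2 n + 1)) ^ 3 := by gcongr
    _ = 2 ^ threshold n m := by
      rw [← pow_mul, ← pow_add, threshold, mul_comm 3]

/-- As n ≥ 2, log n ≥ 1/2, so n ≤ 2 n log n and ⌊log₂ n⌋ ≤ 2 log n. With ⌈m / n⌉ n ≤ m + n, the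
second constant is 42 · 2 + (58 + 20) · 2 = 240. The summand 20 in the first bound is room for the
expected contribution of degrees above the threshold. -/
theorem costs_le {n : ℕ} (m : ℕ) (hn : 2 ≤ n) :
    (baseCost n m + 20 : ℝ) ≤ 92 * (m + n * Real.log n) ∧
      (State.jumpCost n (threshold n m) : ℝ) * n ≤ 240 * (m + n * Real.log n) := by
  have hn2 : (2 : ℝ) ≤ n := by exact_mod_cast hn
  have hm : (0 : ℝ) ≤ m := Nat.cast_nonneg m
  have hlog2 : (1 : ℝ) / 2 < Real.log 2 := by
    have := Real.log_two_gt_d9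
    linarith
  have hlog : (1 : ℝ) / 2 ≤ Real.log n :=
    hlog2.le.trans (Real.log_le_log (by norm_num) hn2)
  have hL : (Nat.log 2 n : ℝ) ≤ 2 * Real.log n := by
    have h1 := Real.natLog_le_logb n 2
    rw [Real.logb, le_div_iff₀ (by exact_mod_cast (by linarith : (0 : ℝ) < Real.log 2))] at h1
    have h2 : (Nat.log 2 n : ℝ) * (1 / 2) ≤ Nat.log 2 n * Real.log 2 := by gcongr
    push_cast at h1
    linarith
  have hq : (⌈(m / n : ℝ)⌉₊ : ℝ) * n ≤ m + n := by
    have h1 := (Nat.ceil_lt_add_one (by positivity : (0 : ℝ) ≤ m / n)).le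
    calc (⌈(m / n : ℝ)⌉₊ : ℝ) * n ≤ (m / n + 1) * n := by gcongr
      _ = m + n := by field_simp
  have hX : (n : ℝ) ≤ 2 * (n * Real.log n) := by nlinarith
  have hLn : (Nat.log 2 n : ℝ) * n ≤ 2 * (n * Real.log n) := by nlinarith
  have hLL : (Nat.log 2 n : ℝ) ≤ Nat.log 2 n * n := by
    have : (0 : ℝ) ≤ Nat.log 2 n := Nat.cast_nonneg _
    nlinarith
  constructor
  · simp only [baseCost, State.haltCost, FibHeap.maxRank]
    push_cast
    linarith
  · simp only [State.jumpCost, FibHeap.maxRank, threshold]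
    push_cast
    calc _ = 42 * ((Nat.log 2 n : ℝ) * n) + 58 * n + 20 * (⌈(m / n : ℝ)⌉₊ * n) := by ring
      _ ≤ _ := by linarith

end ParametricPath

theorem mainTheorem5 (C : NNReal) :
    ∃ A : NNReal,
      ∀ (n m : ℕ), 2 ≤ n →
      ∀ (Ω : Type*) [MeasurableSpace Ω] (μ : Measure Ω) [IsProbabilityMeasure μ]
        (edges : Ω → List (Fin n × Fin n)) (cost : Ω → Fin n × Fin n → ℝ),
        ParametricPath.IsRandomDigraph μ n m edges → Measurable cost →
        ∫⁻ ω, (ParametricPath.pathChanges (edges ω) (cost ω) : ℝ≥0∞) ∂μ ≤ (C : ℝ≥0∞) * n →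
        ∫⁻ ω, (ParametricPath.runningTime (edges ω) (cost ω) : ℝ≥0∞) ∂μ
          ≤ (A : ℝ≥0∞) * ENNReal.ofReal (m + n * Real.log n) := by
  refine ⟨92 + 240 * C, fun n m hn Ω _ μ _ edges cost h _ hJ => ?_⟩
  set T := ParametricPath.threshold n m
  set X : ℝ := m + n * Real.log n
  set B := ParametricPath.baseCost n m
  set G := ParametricPath.State.jumpCost n T
  obtain ⟨hB, hG⟩ := ParametricPath.costs_le m hn
  have hX0 : 0 ≤ X := by
    have := Real.log_natCast_nonneg n
    positivity
  -- The contribution of large degrees: 10 n² · 2n exp(m/n) / 2^T ≤ 20.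
  have hY : (10 * (n * n : ℕ) / 2 ^ T : ℝ≥0∞) *
      ∫⁻ ω, (ParametricPath.degreeExpSum (edges ω) : ℝ≥0∞) ∂μ ≤ 20 := by
    calc _ ≤ (10 * (n * n : ℕ) / 2 ^ T : ℝ≥0∞) * (2 * n * ENNReal.ofReal (Real.exp (m / n))) := by
          gcongr
          exact h.lintegral_degreeExpSum_le hn
      _ = 20 * ENNReal.ofReal (Real.exp (m / n) * (n : ℝ) ^ 3) / 2 ^ T := by
          rw [ENNReal.ofReal_mul (Real.exp_pos _).le, ENNReal.ofReal_pow (Nat.cast_nonneg n),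
            ENNReal.ofReal_natCast]
          simp only [div_eq_mul_inv]
          push_cast
          ring
      _ ≤ 20 * ENNReal.ofReal (2 ^ T) / 2 ^ T := by
          gcongr
          exact ParametricPath.exp_mul_pow_le_two_pow_threshold m
      _ = 20 := by
          rw [ENNReal.ofReal_pow (by norm_num), ENNReal.ofReal_ofNat]
          exact ENNReal.mul_div_cancel_right (by simp) (by simp)
  calc _ ≤ ∫⁻ ω, ((B : ℝ≥0∞) + G * ParametricPath.pathChanges (edges ω) (cost ω)
        + (10 * (n * n : ℕ) / 2 ^ T : ℝ≥0∞) * ParametricPath.degreeExpSum (edges ω)) ∂μ := by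
        refine lintegral_mono fun ω => ?_
        have := ParametricPath.runningTime_le_of_threshold (edges ω) (cost ω) hn T
        rwa [h.length ω] at this
    _ = B + G * ∫⁻ ω, (ParametricPath.pathChanges (edges ω) (cost ω) : ℝ≥0∞) ∂μ
        + (10 * (n * n : ℕ) / 2 ^ T : ℝ≥0∞) *
          ∫⁻ ω, (ParametricPath.degreeExpSum (edges ω) : ℝ≥0∞) ∂μ := by
        -- The integral is split using measurability of the degree term and of the constant only. No
        -- measurability of `pathChanges` is required, as its factor is a finite constant.
        rw [lintegral_add_right _ (h.measurable_comp fun l =>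
            (10 * (n * n : ℕ) / 2 ^ T : ℝ≥0∞) * ParametricPath.degreeExpSum l),
          lintegral_add_left measurable_const, lintegral_const, measure_univ, mul_one,
          lintegral_const_mul' _ _ (ENNReal.natCast_ne_top G),
          lintegral_const_mul _ (h.measurable_comp fun l =>
            (ParametricPath.degreeExpSum l : ℝ≥0∞))]
    _ ≤ B + G * (C * n) + 20 := by gcongr
    _ = ENNReal.ofReal (B + 20 + C * (G * n)) := by
        rw [ENNReal.ofReal_add (by positivity) (by positivity),
          ENNReal.ofReal_add (by positivity) (by positivity),
          ENNReal.ofReal_mul (by positivity), ENNReal.ofReal_mul (by positivity)]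
        simp only [ENNReal.ofReal_natCast, ENNReal.ofReal_coe_nnreal, ENNReal.ofReal_ofNat]
        ring
    _ ≤ ENNReal.ofReal ((92 + 240 * C) * X) := by
        refine ENNReal.ofReal_le_ofReal ?_
        have := mul_le_mul_of_nonneg_left hG C.coe_nonneg
        linarith
    _ = _ := by
        rw [ENNReal.ofReal_mul (by positivity)]
        congr 1
        rw [← ENNReal.ofReal_coe_nnreal]
        push_cast
        rfl
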